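/- Let $p$ be a prime, let $e,m,k,d\ge 1$ be integers, let $q=p^e$, and let $\mathbb{F}_{q^m}$ be the finite field with $q^m$ elements. For $f\in\mathbb{F}_{q^m}[x_1,\ldots,x_k]$ let $N(f=y^q-y)$ denote the number of $(x_1,\ldots,x_k,y)\in\mathbb{F}_{q^m}^{k+1}$ with $f(x_1,\ldots,x_k)=y^q-y$, and let $\nu_p$ be the $p$-adic valuation. Put $g=\gcd\left(d,\frac{q^m-1}{q-1}\right)$. Then for every homogeneous polynomial $f\in\mathbb{F}_{q^m}[x_1,\ldots,x_k]$ of degree $d$ (the zero polynomial included), $$\nu_p\bigl(N(f=y^q-y)\bigr)\ \ge\ \left\lceil \frac{em}{g}\left\lceil\frac{g\,k}{d}\right\rceil\right\rceil .$$ If $g=1$, then for every homogeneous polynomial $f\in\mathbb{F}_{q^m}[x_1,\ldots,x_k]$ of degree $d$, $$\nu_p\bigl(N(f=y^q-y)\bigr)\ \ge\ em\left\lceil\frac{k}{d}\right\rceil ,$$ and there exists a nonzero homogeneous polynomial $f\in\mathbb{F}_{q^m}[x_1,\ldots,x_k]$ of degree $d$ for which equality holds. -/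

import Mathlib

/-- `N(f = y^q - y)`: the number of solutions `(x, y) ∈ F^k × F` of `f(x) = y^q - y`. -/
noncomputable def artinSchreierCount {F : Type*} [Field F] {k : ℕ} (q : ℕ)
    (f : MvPolynomial (Fin k) F) : ℕ :=
  Nat.card {v : (Fin k → F) × F // MvPolynomial.eval v.1 f = v.2 ^ q - v.2}

/-! Write `Q = q ^ m`, `M = (Q - 1) / (q - 1)`, and `S(t) = ∑ x, ψ(t f(x))` for the trace character
`ψ`. Orthogonality expresses the count `N` as the sum of `S(t)` over `t` in the subfield with `q`
elements. The nonzero such `t` are the `M`-th powers in `Fˣ`, each attained `M` times. Homogeneity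
gives `S(t v ^ d) = S(t)`, so `M`-th powers may be replaced by `g`-th powers. Hence `M N + Q ^ k = M
Q ^ k + ∑ s, S(s ^ g)` (`mul_artinSchreierCount_add`), with `M` prime to `p`.

The remaining sum is estimated by Stickelberger's method. Over a local ring containing a primitive
`p`-th root of unity `ζ` and a Teichmüller character `ω`, `ψ` is a polynomial in `ω` whose `j`-th
coefficient is divisible by `(ζ - 1)` to the base `p` digit sum of `j` (`exists_traceChar_eq_sum`).
Expanding `ψ(s ^ g f(x))` monomial by monomial and summing over `s` and `x` leaves only exponent
families satisfying congruences modulo `Q - 1`. Rotating base `p` digits preserves these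
congruences, and averaging over rotations bounds the total digit sum from below
(`mul_le_mul_sum_digits`). Since `(ζ - 1) ^ (p - 1)` is associated to `p`, this yields the valuation
bound.

For `g = 1` the double sum is `Q` times the number of zeros of `f`. Sharpness then follows from sums
of monomials in disjoint blocks of variables, whose zeros can be counted recursively
(`exists_isHomogeneous_natCard_zeros`). -/

/-! ### Base `p` digit sums and digit rotation. -/

theorem Nat.sum_digits_eq_mod_add {p : ℕ} (hp : 1 < p) (j : ℕ) :
    (p.digits j).sum = j % p + (p.digits (j / p)).sum := by
  rcases Nat.eq_zero_or_pos j with rfl | hj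
  · simp
  · rw [Nat.digits_def' hp hj, List.sum_cons]

/-- The digit-sum identity behind Legendre's formula, by induction on the number of digits. -/
theorem Nat.sub_one_mul_sum_div_pow_add_sum_digits {p : ℕ} (hp : 1 < p) (f : ℕ) :
    ∀ j < p ^ f, (p - 1) * ∑ i ∈ Finset.range f, j / p ^ (i + 1) + (p.digits j).sum = j := by
  induction f with
  | zero => intro j hj; simp at hj; simp [hj]
  | succ f ih =>
    intro j hj
    have hb : j / p < p ^ f := Nat.div_lt_of_lt_mul (by rwa [← pow_succ'])
    have h := ih _ hb
    rw [Finset.sum_range_succ', Nat.sum_digits_eq_mod_add hp]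
    have h2 : ∀ i, j / p ^ (i + 1 + 1) = j / p / p ^ (i + 1) := fun i => by
      rw [Nat.div_div_eq_div_mul, _root_.pow_succ' p (i + 1)]
    simp only [h2, zero_add, pow_one]
    have h3 := Nat.div_add_mod j p
    obtain ⟨c, rfl⟩ : ∃ c, p = c + 1 := ⟨p - 1, by omega⟩
    simp only [Nat.add_sub_cancel] at *
    nlinarith

/-- The digit sums of `j` and of its complement `p ^ f - 1 - j` add up to `f (p - 1)`. -/
theorem Nat.sum_digits_add_sum_digits_compl {p : ℕ} (hp : 1 < p) (f : ℕ) :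
    ∀ a b, a + b + 1 = p ^ f → (p.digits a).sum + (p.digits b).sum = f * (p - 1) := by
  induction f with
  | zero =>
    intro a b h
    obtain ⟨rfl, rfl⟩ : a = 0 ∧ b = 0 := by simp at h; omega
    simp
  | succ f ih =>
    intro a b h
    rw [Nat.sum_digits_eq_mod_add hp a, Nat.sum_digits_eq_mod_add hp b]
    have ha := Nat.div_add_mod a p
    have hb := Nat.div_add_mod b p
    have ha' := Nat.mod_lt a (by omega : 0 < p)
    have hb' := Nat.mod_lt b (by omega : 0 < p)
    have key : p * (a / p + b / p) + (a % p + b % p + 1) = p * p ^ f := by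
      rw [← pow_succ', ← h]; nlinarith
    have hdvd : p ∣ a % p + b % p + 1 :=
      (Nat.dvd_add_right (Dvd.intro _ rfl)).1 (key ▸ Dvd.intro _ rfl)
    -- A multiple of `p` lying between `1` and `2p - 1`: the last digits are complementary and
    -- nothing is borrowed from the higher ones.
    have hs : a % p + b % p + 1 = p := by
      obtain ⟨c, hc⟩ := hdvd
      have h1 : c < 2 := by
        by_contra hcc
        have : p * 2 ≤ p * c := Nat.mul_le_mul_left _ (by omega)
        omega
      have h2 : c ≠ 0 := by rintro rfl; omega
      obtain rfl : c = 1 := by omega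
      omega
    have hq : a / p + b / p + 1 = p ^ f := by
      rw [hs] at key
      exact Nat.eq_of_mul_eq_mul_left (by omega : 0 < p) (by linarith)
    have := ih _ _ hq
    rw [add_mul, one_mul]
    omega

/-- Rotation by `r` places of the base `p` expansion of `j`, written with `f` digits. -/
def digitRotate (p f r j : ℕ) : ℕ := p ^ r * (j % p ^ (f - r)) + j / p ^ (f - r)

theorem digitRotate_add {p f r : ℕ} (hp : 1 < p) (hr : r ≤ f) (j : ℕ) :
    digitRotate p f r j + (p ^ f - 1) * (j / p ^ (f - r)) = p ^ r * j := by
  have h1 : p ^ f = p ^ r * p ^ (f - r) := by rw [← pow_add]; congr 1; omega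
  have h2 := Nat.div_add_mod j (p ^ (f - r))
  obtain ⟨c, hc⟩ : ∃ c, p ^ f = c + 1 :=
    ⟨p ^ f - 1, by have : 0 < p ^ f := pow_pos (by omega) _; omega⟩
  rw [digitRotate, hc, Nat.add_sub_cancel]
  calc _ = p ^ r * (j % p ^ (f - r)) + (c + 1) * (j / p ^ (f - r)) := by ring
    _ = p ^ r * (p ^ (f - r) * (j / p ^ (f - r)) + j % p ^ (f - r)) := by rw [← hc, h1]; ring
    _ = _ := by rw [h2]

theorem digitRotate_modEq {p f r : ℕ} (hp : 1 < p) (hr : r ≤ f) (j : ℕ) :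
    digitRotate p f r j ≡ p ^ r * j [MOD p ^ f - 1] := by
  rw [← digitRotate_add hp hr]
  simp [Nat.ModEq]

theorem digitRotate_pos {p f r j : ℕ} (hp : 1 < p) (hj : j ≠ 0) : 0 < digitRotate p f r j := by
  by_contra h
  have h0 : digitRotate p f r j = 0 := by omega
  have hpr : p ^ r ≠ 0 := pow_ne_zero _ (by omega)
  simp only [digitRotate, Nat.add_eq_zero_iff, mul_eq_zero, hpr, false_or] at h0
  have := Nat.div_add_mod j (p ^ (f - r))
  rw [h0.1, h0.2] at this
  simp at this
  exact hj this.symm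

/-- Over all rotations each digit visits each place once, so it is weighted by `1 + p + ⋯ + p ^ (f -
1) = (p ^ f - 1) / (p - 1)`. -/
theorem sub_one_mul_sum_digitRotate {p f j : ℕ} (hp : 1 < p) (hj : j < p ^ f) :
    (p - 1) * ∑ r ∈ Finset.range f, digitRotate p f r j = (p ^ f - 1) * (p.digits j).sum := by
  have h1 := Nat.sub_one_mul_sum_div_pow_add_sum_digits hp f j hj
  have h2 : ∑ r ∈ Finset.range f, digitRotate p f r j +
      (p ^ f - 1) * ∑ r ∈ Finset.range f, j / p ^ (f - r) = (∑ r ∈ Finset.range f, p ^ r) * j := by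
    rw [Finset.mul_sum, ← Finset.sum_add_distrib, Finset.sum_mul]
    exact Finset.sum_congr rfl fun r hr => digitRotate_add hp (Finset.mem_range.1 hr).le j
  have h3 : ∑ r ∈ Finset.range f, j / p ^ (f - r) = ∑ i ∈ Finset.range f, j / p ^ (i + 1) := by
    rw [← Finset.sum_range_reflect]
    refine Finset.sum_congr rfl fun r hr => ?_
    have := Finset.mem_range.1 hr
    congr 2; omega
  have h4 : (∑ r ∈ Finset.range f, p ^ r) * (p - 1) = p ^ f - 1 := by
    rw [Nat.geomSum_eq hp, Nat.div_mul_cancel]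
    simpa using Nat.sub_dvd_pow_sub_pow p 1 f
  rw [h3] at h2
  generalize ∑ r ∈ Finset.range f, digitRotate p f r j = A at *
  generalize ∑ i ∈ Finset.range f, j / p ^ (i + 1) = B at *
  generalize ∑ r ∈ Finset.range f, p ^ r = C at *
  generalize (p.digits j).sum = S at *
  generalize p - 1 = c at *
  generalize p ^ f - 1 = D at *
  have h5 : c * A + D * (c * B) = D * (c * B + S) := by
    rw [h1]; nlinarith
  nlinarith

/-- The digit sums of solutions of a system of congruences modulo `p ^ f - 1` with nonnegative
coefficients of constant column sum are large. -/
theorem mul_le_mul_sum_digits {A ι : Type*} [Fintype ι] {p f d g W : ℕ} (hp : 1 < p) (hf : f ≠ 0)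
    (hd : 0 < d)
    (s : Finset A) (J : A → ℕ) (hJ : ∀ a ∈ s, J a < p ^ f) (α : A → ι → ℕ)
    (hα : ∀ a ∈ s, ∑ v, α a v = d) (hs : p ^ f - 1 ∣ g * ∑ a ∈ s, J a)
    (hv : ∀ v, p ^ f - 1 ∣ ∑ a ∈ s, J a * α a v)
    (hW : ∀ B, g * Fintype.card ι ≤ d * B → W ≤ B) :
    (p - 1) * f * W ≤ g * (∑ a ∈ s, (p.digits (J a)).sum +
      (p - 1) * f * (Finset.univ.filter fun v => ∑ a ∈ s, J a * α a v = 0).card) := by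
  classical
  set V := Finset.univ.filter fun v => ∑ a ∈ s, J a * α a v = 0 with hV
  set D := p ^ f - 1 with hD
  have hDpos : 0 < D := by
    have : 1 < p ^ f := Nat.one_lt_pow hf hp
    omega
  have hdiv : ∀ r ≤ f, ∀ c : A → ℕ, D ∣ ∑ a ∈ s, J a * c a →
      D ∣ ∑ a ∈ s, digitRotate p f r (J a) * c a := fun r hr c hc => by
    have h : ∑ a ∈ s, digitRotate p f r (J a) * c a ≡ p ^ r * ∑ a ∈ s, J a * c a [MOD D] := by
      rw [Finset.mul_sum]
      refine Nat.ModEq.sum fun a _ => ?_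
      rw [← mul_assoc]
      exact (digitRotate_modEq hp hr _).mul_right _
    exact (h.dvd_iff dvd_rfl).2 (hc.mul_left _)
  -- A bound for each single rotation; summing over `r` then turns rotated values into digit sums.
  -- Indices in `V` impose no lower bound on the rotated sum and are paid for by the `V.card` term.
  have hB : ∀ r ∈ Finset.range f,
      D * W ≤ g * ∑ a ∈ s, digitRotate p f r (J a) + D * (g * V.card) := fun r hr => by
    have hr' := (Finset.mem_range.1 hr).le
    have h1 : D ∣ g * ∑ a ∈ s, digitRotate p f r (J a) := by
      have := hdiv r hr' (fun _ => g) (by rwa [← Finset.sum_mul, mul_comm])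
      rwa [← Finset.sum_mul, mul_comm] at this
    obtain ⟨B, hB⟩ := h1
    rw [hB, ← mul_add]
    refine Nat.mul_le_mul_left _ (hW _ ?_)
    -- Rotation keeps nonzero entries nonzero, so this is a positive multiple of `D`.
    have h2 : ∀ v ∈ Vᶜ, D ≤ ∑ a ∈ s, digitRotate p f r (J a) * α a v := fun v hvV => by
      refine Nat.le_of_dvd ?_ (hdiv r hr' _ (hv v))
      have hne : ∑ a ∈ s, J a * α a v ≠ 0 := by simpa [hV] using hvV
      obtain ⟨a, has, ha⟩ := Finset.exists_ne_zero_of_sum_ne_zero hne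
      refine Finset.sum_pos' (fun _ _ => Nat.zero_le _) ⟨a, has, ?_⟩
      exact Nat.mul_pos (digitRotate_pos hp (left_ne_zero_of_mul ha))
        (Nat.pos_of_ne_zero (right_ne_zero_of_mul ha))
    have h3 : D * Vᶜ.card ≤ d * ∑ a ∈ s, digitRotate p f r (J a) := by
      calc D * Vᶜ.card = ∑ v ∈ Vᶜ, D := by simp [mul_comm]
        _ ≤ ∑ v ∈ Vᶜ, ∑ a ∈ s, digitRotate p f r (J a) * α a v := Finset.sum_le_sum h2
        _ ≤ ∑ v, ∑ a ∈ s, digitRotate p f r (J a) * α a v :=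
          Finset.sum_le_sum_of_subset (Finset.subset_univ _)
        _ = d * ∑ a ∈ s, digitRotate p f r (J a) := by
          rw [Finset.sum_comm, Finset.mul_sum]
          refine Finset.sum_congr rfl fun a ha => ?_
          rw [← Finset.mul_sum, hα a ha, mul_comm]
    have h4 : Fintype.card ι = Vᶜ.card + V.card := by
      rw [Finset.card_compl, Nat.sub_add_cancel (Finset.card_le_univ _)]
    have h5 : g * Vᶜ.card ≤ d * B := by
      refine Nat.le_of_mul_le_mul_left ?_ hDpos
      calc D * (g * Vᶜ.card) = g * (D * Vᶜ.card) := by ring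
        _ ≤ g * (d * ∑ a ∈ s, digitRotate p f r (J a)) := Nat.mul_le_mul_left _ h3
        _ = d * (g * ∑ a ∈ s, digitRotate p f r (J a)) := by ring
        _ = D * (d * B) := by rw [hB]; ring
    rw [h4, mul_add, mul_add]
    exact Nat.add_le_add h5 (Nat.le_mul_of_pos_left _ hd)
  have hsum := Finset.sum_le_sum hB
  rw [Finset.sum_const, Finset.card_range, Finset.sum_add_distrib, Finset.sum_const,
    Finset.card_range, ← Finset.mul_sum, Finset.sum_comm] at hsum
  have hrot : (p - 1) * ∑ a ∈ s, ∑ r ∈ Finset.range f, digitRotate p f r (J a) =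
      D * ∑ a ∈ s, (p.digits (J a)).sum := by
    rw [Finset.mul_sum, Finset.mul_sum]
    exact Finset.sum_congr rfl fun a ha => sub_one_mul_sum_digitRotate hp (hJ a ha)
  refine Nat.le_of_mul_le_mul_left ?_ hDpos
  calc D * ((p - 1) * f * W) = (p - 1) * (f • (D * W)) := by simp only [smul_eq_mul]; ring
    _ ≤ _ := Nat.mul_le_mul_left _ hsum
    _ = g * ((p - 1) * ∑ a ∈ s, ∑ r ∈ Finset.range f, digitRotate p f r (J a)) +
        D * (g * ((p - 1) * f * V.card)) := by simp only [smul_eq_mul]; ring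
    _ = _ := by rw [hrot]; ring

/-! ### Gauss sums of Teichmüller characters and Stickelberger's digit-sum valuations. -/

section GaussSums

open IsLocalRing

/-- The additive character `x ↦ ζ ^ Tr(x)` of a finite field of characteristic `p`. -/
noncomputable def traceChar (F : Type*) {R : Type*} [Field F] [CommRing R] {p : ℕ}
    [Fact p.Prime] [Algebra (ZMod p) F] {ζ : R} (hζ : ζ ^ p = 1) : AddChar F R :=
  (AddChar.zmodChar p hζ).compAddMonoidHom (Algebra.trace (ZMod p) F).toAddMonoidHom

section Primitive

variable {F R : Type*} [Field F] [CommRing R] {p : ℕ} [Fact p.Prime] [Algebra (ZMod p) F] {ζ : R}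

theorem traceChar_apply (hζ : ζ ^ p = 1) (x : F) :
    traceChar F hζ x = ζ ^ (Algebra.trace (ZMod p) F x).val := by
  simp [traceChar, AddChar.zmodChar_apply]

theorem traceChar_pow_char_pow [Finite F] (hζ : ζ ^ p = 1) (n : ℕ) (x : F) :
    traceChar F hζ (x ^ p ^ n) = traceChar F hζ x := by
  induction n generalizing x with
  | zero => simp
  | succ n ih =>
    rw [pow_succ', pow_mul, ih, traceChar_apply, traceChar_apply]
    have h := Algebra.trace_eq_of_algEquiv
      (FiniteField.frobeniusAlgEquivOfAlgebraic (ZMod p) F) x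
    rw [FiniteField.coe_frobeniusAlgEquivOfAlgebraic, ZMod.card] at h
    rw [h]

theorem traceChar_isPrimitive [Finite F] (hζ : IsPrimitiveRoot ζ p) :
    (traceChar F hζ.pow_eq_one).IsPrimitive := by
  refine AddChar.IsPrimitive.of_ne_one (AddChar.ne_one_iff.2 ?_)
  obtain ⟨x, hx⟩ := Algebra.trace_surjective (ZMod p) F 1
  refine ⟨x, ?_⟩
  rw [traceChar_apply, hx, ZMod.val_one, pow_one]
  exact hζ.ne_one (Fact.out : p.Prime).one_lt

/-- The product of `ζ ^ k - 1` over `0 < k < p` is `p` up to sign, and all its factors are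
associated to `ζ - 1`. -/
theorem IsPrimitiveRoot.associated_sub_one_pow [IsDomain R] (hζ : IsPrimitiveRoot ζ p) :
    Associated ((ζ - 1) ^ (p - 1)) (p : R) := by
  have hp := (Fact.out : p.Prime)
  obtain ⟨n, rfl⟩ : ∃ n, p = n + 1 := ⟨p - 1, by have := hp.one_lt; omega⟩
  rw [Nat.add_sub_cancel, Nat.cast_add, Nat.cast_one, ← hζ.prod_pow_sub_one_eq_order]
  have h : Associated (∏ _k ∈ Finset.range n, (ζ - 1))
      (∏ k ∈ Finset.range n, (ζ ^ (k + 1) - 1)) := by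
    refine Associated.prod _ _ _ fun k hk => ?_
    refine hζ.associated_sub_one_pow_sub_one_of_coprime ?_
    have := Finset.mem_range.1 hk
    exact (Nat.coprime_of_lt_prime (by omega) (by omega) hp).symm
  rw [Finset.prod_const, Finset.card_range] at h
  exact h.trans (associated_unit_mul_right _ _ ((isUnit_one.neg).pow n))

end Primitive

theorem sum_units {F A : Type*} [Field F] [Fintype F] [Fintype Fˣ] [AddCommMonoid A]
    {h : F → A} (h0 : h 0 = 0) : ∑ u : Fˣ, h u = ∑ x, h x :=
  Fintype.sum_of_injective _ Units.val_injective _ _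
    (fun x hx => by
      by_cases hx0 : x = 0
      · rw [hx0, h0]
      · exact (hx ⟨Units.mk0 x hx0, rfl⟩).elim) fun _ => rfl

theorem teichmuller_pow_card_sub_one {F R : Type*} [Field F] [Fintype F] [CommRing R]
    (ω : MulChar F R) {x : F} (hx : x ≠ 0) :
    ω x ^ (Fintype.card F - 1) = 1 := by
  rw [← map_pow, FiniteField.pow_card_sub_one_eq_one x hx, map_one]

theorem associated_sub_one_pow_card {F R : Type*} [Fintype F] [CommRing R] [IsDomain R]
    {p f : ℕ} [Fact p.Prime] {ζ : R} (hζ : IsPrimitiveRoot ζ p) (hF : Fintype.card F = p ^ f) :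
    Associated ((ζ - 1) ^ (f * (p - 1))) (Fintype.card F : R) := by
  rw [hF, Nat.cast_pow, mul_comm, pow_mul]
  exact hζ.associated_sub_one_pow.pow_pow

/-- Frobenius permutes `F` and preserves the trace. This makes the Gauss sum insensitive to a
trailing zero digit of the exponent. -/
theorem gaussSum_pow_char {F R : Type*} [Field F] [Fintype F] [CommRing R] {p : ℕ}
    [Fact p.Prime] [Algebra (ZMod p) F] {ζ : R} (hζ : IsPrimitiveRoot ζ p) (χ : MulChar F R) :
    gaussSum (χ ^ p) (traceChar F hζ.pow_eq_one) = gaussSum χ (traceChar F hζ.pow_eq_one) := by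
  have hp := (Fact.out : p.Prime)
  have : CharP F p := charP_of_injective_algebraMap (algebraMap (ZMod p) F).injective p
  have : ExpChar F p := ExpChar.prime hp
  rw [gaussSum, gaussSum, ← (Equiv.ofBijective _ (bijective_frobenius F p)).sum_comp
    fun x => χ x * _]
  refine Finset.sum_congr rfl fun x _ => ?_
  have h := traceChar_pow_char_pow hζ.pow_eq_one 1 x
  rw [pow_one] at h
  rw [Equiv.ofBijective_apply, frobenius_def, h, MulChar.pow_apply' _ hp.ne_zero, map_pow]

section Teichmuller

variable {F R : Type*} [Field F] [CommRing R] [IsLocalRing R]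
  {ι : F →+* ResidueField R} {ω : MulChar F R}

theorem teichmuller_injective (hω : ∀ x, residue R (ω x) = ι x) : Function.Injective ω :=
  fun x y h => ι.injective (by rw [← hω, ← hω, h])

theorem natCast_residue_eq_zero (p : ℕ) [Fact p.Prime] [Algebra (ZMod p) F]
    (ι : F →+* ResidueField R) : residue R (p : R) = 0 := by
  have : CharP F p := charP_of_injective_algebraMap (algebraMap (ZMod p) F).injective p
  rw [map_natCast, ← map_natCast ι, CharP.cast_eq_zero, map_zero]

theorem residue_primitiveRoot_sub_one [IsDomain R] {p : ℕ} [Fact p.Prime]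
    [Algebra (ZMod p) F] {ζ : R} (ι : F →+* ResidueField R) (hζ : IsPrimitiveRoot ζ p) :
    residue R (ζ - 1) = 0 := by
  have h := (hζ.associated_sub_one_pow.map (residue R))
  rw [natCast_residue_eq_zero p ι, map_pow] at h
  exact pow_eq_zero_iff (by have := (Fact.out : p.Prime).one_lt; omega) |>.1
    ((associated_zero_iff_eq_zero _).1 h)

variable [Fintype F]

theorem teichmuller_pow_ne_one (hω : ∀ x, residue R (ω x) = ι x) {n : ℕ}
    (hn : ¬ Fintype.card F - 1 ∣ n) : ω ^ n ≠ 1 := by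
  intro h
  apply hn
  rw [← FiniteField.forall_pow_eq_one_iff F n]
  intro x
  have hx := congrArg (fun χ : MulChar F R => residue R (χ x)) h
  simp only [MulChar.pow_apply_coe, MulChar.one_apply_coe, map_pow, map_one, hω] at hx
  exact Units.ext (ι.injective (by simpa using hx))

theorem teichmuller_inv_pow_ne_one (hω : ∀ x, residue R (ω x) = ι x) {n : ℕ}
    (hn : ¬ Fintype.card F - 1 ∣ n) : ω⁻¹ ^ n ≠ 1 := by
  rw [inv_pow, inv_ne_one]
  exact teichmuller_pow_ne_one hω hn

theorem teichmuller_sum_pow [IsDomain R] (hω : ∀ x, residue R (ω x) = ι x) {n : ℕ}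
    (hn : ¬ Fintype.card F - 1 ∣ n) : ∑ x, ω x ^ n = 0 := by
  have hn0 : n ≠ 0 := by rintro rfl; simp at hn
  rw [← MulChar.sum_eq_zero_of_ne_one (teichmuller_pow_ne_one hω hn)]
  exact Finset.sum_congr rfl fun x _ => (MulChar.pow_apply' ω hn0 x).symm

variable {p f : ℕ} [Fact p.Prime] [Algebra (ZMod p) F]

theorem card_sub_one_isUnit (ι : F →+* ResidueField R) : IsUnit ((Fintype.card F : R) - 1) := by
  rw [← residue_ne_zero_iff_isUnit, map_sub, map_natCast, map_one, ← map_natCast ι,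
    FiniteField.cast_card_eq_zero, map_zero, zero_sub]
  exact neg_ne_zero.2 one_ne_zero

variable [IsDomain R] {ζ : R}

/-- The Gauss sum of the inverse Teichmüller character has the valuation of `ζ - 1`. -/
theorem associated_gaussSum_teichmuller_inv (hω : ∀ x, residue R (ω x) = ι x)
    (hζ : IsPrimitiveRoot ζ p) (hF : 2 < Fintype.card F) :
    Associated (ζ - 1) (gaussSum ω⁻¹ (traceChar F hζ.pow_eq_one)) := by
  classical
  have hp := (Fact.out : p.Prime)
  let G : F → R := fun x => ∑ i ∈ Finset.range (Algebra.trace (ZMod p) F x).val, ζ ^ i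
  have hG : ∀ x, residue R (G x) = ι (algebraMap (ZMod p) F (Algebra.trace (ZMod p) F x)) := by
    intro x
    have h1 : residue R ζ = 1 := by
      have := residue_primitiveRoot_sub_one ι hζ
      rwa [map_sub, map_one, sub_eq_zero] at this
    simp only [G, map_sum, map_pow, h1, one_pow, Finset.sum_const, Finset.card_range, nsmul_eq_mul,
      mul_one]
    generalize Algebra.trace (ZMod p) F x = t
    conv_rhs => rw [← ZMod.natCast_zmod_val t, map_natCast, map_natCast]
  have hne : ω⁻¹ ≠ 1 := by
    have := teichmuller_inv_pow_ne_one hω (n := 1)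
      (by rw [Nat.dvd_one]; omega)
    rwa [pow_one] at this
  -- Since `∑ ω⁻¹ = 0`, each `ζ ^ Tr x` may be replaced by `ζ ^ Tr x - 1 = (ζ - 1) G(x)`, where
  -- `G(x)` reduces to `Tr x`.
  have hsum : gaussSum ω⁻¹ (traceChar F hζ.pow_eq_one) = (ζ - 1) * ∑ x, ω⁻¹ x * G x := by
    rw [gaussSum, ← sub_zero (∑ x, _), ← MulChar.sum_eq_zero_of_ne_one hne,
      ← Finset.sum_sub_distrib, Finset.mul_sum]
    refine Finset.sum_congr rfl fun x _ => ?_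
    rw [traceChar_apply, mul_left_comm, mul_geom_sum]
    ring
  rw [hsum]
  refine associated_mul_unit_right _ _ ((residue_ne_zero_iff_isUnit _).1 ?_)
  have hres : residue R (∑ x, ω⁻¹ x * G x) =
      ι (∑ x : F, x⁻¹ * algebraMap (ZMod p) F (Algebra.trace (ZMod p) F x)) := by
    rw [map_sum, map_sum]
    refine Finset.sum_congr rfl fun x _ => ?_
    rw [map_mul, hG, MulChar.inv_apply', hω, map_mul]
  have hunits : ∑ x : F, x⁻¹ * algebraMap (ZMod p) F (Algebra.trace (ZMod p) F x) =
      ∑ x : Fˣ, ∑ i ∈ Finset.range (Module.finrank (ZMod p) F), (x ^ (p ^ i - 1) : F) := by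
    rw [← sum_units (by simp)]
    refine Finset.sum_congr rfl fun x _ => ?_
    rw [FiniteField.algebraMap_trace_eq_sum_pow, Finset.mul_sum]
    refine Finset.sum_congr rfl fun i _ => ?_
    rw [Nat.card_zmod, inv_mul_eq_iff_eq_mul₀ x.ne_zero, ← pow_succ', Nat.sub_add_cancel]
    exact Nat.one_le_pow _ _ hp.pos
  rw [hres, hunits, Finset.sum_comm]
  simp only [FiniteField.sum_pow_units]
  have hcard : Fintype.card F = p ^ Module.finrank (ZMod p) F := by
    rw [Module.card_eq_pow_finrank (K := ZMod p), ZMod.card]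
  -- In the sum of `x ^ (p ^ i - 1)` over units only `i = 0` survives, giving `-1`; hence the
  -- cofactor of `ζ - 1` is a unit.
  rw [Finset.sum_eq_single_of_mem 0 (Finset.mem_range.2 Module.finrank_pos)]
  · simp
  · intro i hi hi0
    rw [if_neg]
    intro hdvd
    have h1 : p ^ i < p ^ Module.finrank (ZMod p) F :=
      Nat.pow_lt_pow_right hp.one_lt (Finset.mem_range.1 hi)
    have h2 : 1 < p ^ i := Nat.one_lt_pow hi0 hp.one_lt
    have := Nat.le_of_dvd (by omega) hdvd
    omega

/-- Upper bound for the valuation of a Gauss sum in terms of digit sums. -/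
theorem gaussSum_teichmuller_inv_pow_dvd (hω : ∀ x, residue R (ω x) = ι x)
    (hζ : IsPrimitiveRoot ζ p) (a : ℕ) (ha : a < Fintype.card F - 1) :
    gaussSum (ω⁻¹ ^ a) (traceChar F hζ.pow_eq_one) ∣ (ζ - 1) ^ (p.digits a).sum := by
  have hp := (Fact.out : p.Prime)
  induction a using Nat.strong_induction_on with
  | _ a ih =>
    rcases Nat.eq_zero_or_pos a with rfl | ha0
    · rw [pow_zero, gaussSum_one_left]
      · simp
      · exact AddChar.ne_one_iff.2 (by
          have h := traceChar_isPrimitive (F := F) hζ one_ne_zero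
          rw [AddChar.mulShift_one] at h
          exact AddChar.ne_one_iff.1 h)
    by_cases hpa : p ∣ a
    · obtain ⟨b, rfl⟩ := hpa
      have hb : b < p * b := by
        have := hp.one_lt
        have : 0 < b := Nat.pos_of_mul_pos_left ha0
        nlinarith
      rw [mul_comm, pow_mul, gaussSum_pow_char hζ, Nat.sum_digits_eq_mod_add hp.one_lt,
        Nat.mul_mod_left, zero_add, Nat.mul_div_cancel _ hp.pos]
      exact ih b hb (hb.trans ha)
    · obtain ⟨b, rfl⟩ : ∃ b, a = b + 1 := ⟨a - 1, by omega⟩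
      -- When `p` does not divide `b + 1`, adding one to `b` causes no carry, and the Jacobi sum
      -- relation shows that the Gauss sum at `b + 1` divides the product of those at `b` and `1`.
      have hJ := jacobiSum_mul_nontrivial (χ := ω⁻¹ ^ b) (φ := ω⁻¹)
        (by rw [← pow_succ]
            exact teichmuller_inv_pow_ne_one hω fun h => by have := Nat.le_of_dvd ha0 h; omega)
        (traceChar F hζ.pow_eq_one)
      have hσ : (p.digits (b + 1)).sum = (p.digits b).sum + 1 := by
        have h1 := Nat.div_add_mod b p
        have h2 := Nat.mod_lt b hp.pos
        have h3 : b % p + 1 < p := by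
          by_contra hlt
          apply hpa
          refine ⟨b / p + 1, ?_⟩
          rw [mul_add]; omega
        have h4 : (b + 1) / p = b / p ∧ (b + 1) % p = b % p + 1 := by
          rw [Nat.div_mod_unique hp.pos]
          omega
        rw [Nat.sum_digits_eq_mod_add hp.one_lt (b + 1), Nat.sum_digits_eq_mod_add hp.one_lt b,
          h4.1, h4.2]
        ring
      rw [hσ, pow_succ, pow_succ]
      refine (Dvd.intro _ hJ).trans (mul_dvd_mul (ih b (by omega) (by omega)) ?_)
      exact (associated_gaussSum_teichmuller_inv hω hζ (by omega)).symm.dvd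

/-- Lower bound for the valuation of a Gauss sum in terms of digit sums. -/
theorem pow_sum_digits_dvd_gaussSum (hω : ∀ x, residue R (ω x) = ι x)
    (hζ : IsPrimitiveRoot ζ p) (hF : Fintype.card F = p ^ f) {a : ℕ} (ha0 : a ≠ 0)
    (ha : a < Fintype.card F - 1) :
    (ζ - 1) ^ (p.digits a).sum ∣ gaussSum (ω⁻¹ ^ a) (traceChar F hζ.pow_eq_one) := by
  have hp := (Fact.out : p.Prime)
  set ψ := traceChar F hζ.pow_eq_one with hψ
  obtain ⟨b, hb⟩ : ∃ b, a + b + 1 = p ^ f := ⟨p ^ f - 1 - a, by omega⟩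
  have hne : ω⁻¹ ^ a ≠ 1 :=
    teichmuller_inv_pow_ne_one hω fun h => by have := Nat.le_of_dvd (by omega) h; omega
  have hinv : (ω⁻¹ ^ a)⁻¹ = ω⁻¹ ^ b := by
    rw [inv_eq_iff_mul_eq_one, ← pow_add]
    have hab : a + b = Fintype.card F - 1 := by omega
    ext x
    rw [MulChar.pow_apply_coe, MulChar.one_apply_coe, hab]
    exact teichmuller_pow_card_sub_one _ x.ne_zero
  -- The two complementary Gauss sums multiply to `Q`, of exponent `f (p - 1)`, so the upper bound
  -- at `b` becomes a lower bound at `a`.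
  have hmul := gaussSum_mul_gaussSum_eq_card hne (traceChar_isPrimitive hζ)
  rw [hinv, ← hψ] at hmul
  have hup := gaussSum_teichmuller_inv_pow_dvd hω hζ b (by omega)
  rw [← mul_gaussSum_inv_eq_gaussSum, ← hψ] at hup
  have hup' := (Dvd.intro_left _ rfl).trans hup
  have hne0 : ζ - 1 ≠ 0 := sub_ne_zero.2 (hζ.ne_one hp.one_lt)
  have hdvd : (ζ - 1) ^ (f * (p - 1)) ∣
      gaussSum (ω⁻¹ ^ a) ψ * (ζ - 1) ^ (p.digits b).sum :=
    (associated_sub_one_pow_card hζ hF).dvd.trans (hmul ▸ mul_dvd_mul_left _ hup')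
  rw [← Nat.sum_digits_add_sum_digits_compl hp.one_lt f a b hb, pow_add] at hdvd
  exact (mul_dvd_mul_iff_right (pow_ne_zero _ hne0)).1 hdvd

/-- The expansion of the additive character `ζ ^ Tr(x)` in powers of the Teichmüller character. -/
theorem exists_traceChar_eq_sum (hω : ∀ x, residue R (ω x) = ι x)
    (hζ : IsPrimitiveRoot ζ p) (hF : Fintype.card F = p ^ f) :
    ∃ c : ℕ → R, (∀ j < Fintype.card F, (ζ - 1) ^ (p.digits j).sum ∣ c j) ∧
      ∀ x : F, traceChar F hζ.pow_eq_one x = ∑ j ∈ Finset.range (Fintype.card F), c j * ω x ^ j := by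
  classical
  have hp := (Fact.out : p.Prime)
  set ψ := traceChar F hζ.pow_eq_one with hψ
  have hψ1 : ψ ≠ 1 := by
    have h := traceChar_isPrimitive (F := F) hζ one_ne_zero
    rwa [AddChar.mulShift_one] at h
  obtain ⟨u, hu⟩ := card_sub_one_isUnit ι
  obtain ⟨n, hn⟩ : ∃ n, Fintype.card F = n + 1 + 1 :=
    ⟨Fintype.card F - 2, by have := Fintype.one_lt_card (α := F); omega⟩
  have hun : (u : R) = (n : R) + 1 := by rw [hu, hn]; push_cast; ring
  -- Fourier coefficients on `Fˣ`, with the trivial character's coefficient `-1 / (Q - 1)` split as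
  -- `1 - Q / (Q - 1)` between `j = 0` and `j = Q - 1`. The split makes the formula hold at `x = 0`,
  -- where only `j = 0` contributes, and `Q` matches the digit sum `f (p - 1)` of `Q - 1`.
  let c : ℕ → R := fun j => if j = 0 then 1 else
    ↑u⁻¹ * if j = n + 1 then -(Fintype.card F : R) else gaussSum (ω⁻¹ ^ j) ψ
  refine ⟨c, fun j hj => ?_, fun x => ?_⟩
  · simp only [c]
    split_ifs with h0 h1
    · simp [h0]
    · refine Dvd.dvd.mul_left ?_ _
      rw [dvd_neg]
      have := Nat.sum_digits_add_sum_digits_compl hp.one_lt f (n + 1) 0 (by omega)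
      simp only [Nat.digits_zero, List.sum_nil, add_zero] at this
      rw [h1, this]
      exact (associated_sub_one_pow_card hζ hF).dvd
    · exact (pow_sum_digits_dvd_gaussSum hω hζ hF h0 (by omega)).mul_left _
  · rw [hn, Finset.sum_range_succ, Finset.sum_range_succ']
    have hc0 : c 0 = 1 := by simp [c]
    have hcn : c (n + 1) = ↑u⁻¹ * -(Fintype.card F : R) := by simp [c]
    have hcj : ∀ j ∈ Finset.range n, c (j + 1) = ↑u⁻¹ * gaussSum (ω⁻¹ ^ (j + 1)) ψ := by
      intro j hj
      have := Finset.mem_range.1 hj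
      simp only [c]
      rw [if_neg (by omega), if_neg (by omega)]
    rw [hc0, hcn, Finset.sum_congr rfl fun j hj => by rw [hcj j hj]]
    rcases eq_or_ne x 0 with rfl | hx
    · simp [MulChar.map_zero]
    have hpow := teichmuller_pow_card_sub_one ω hx
    rw [hn, Nat.add_sub_cancel] at hpow
    have hgeom : ∀ y : F, y ≠ 0 → ∑ j ∈ Finset.range (n + 1), ω (y⁻¹ * x) ^ j =
        if y = x then (u : R) else 0 := by
      intro y hy
      split_ifs with hyx
      · subst hyx
        simp [hy, hun]
      · have h1 : ω (y⁻¹ * x) ≠ 1 := by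
          rw [← map_one ω]
          intro h
          have := teichmuller_injective hω h
          exact hyx (by rw [inv_mul_eq_one₀ hy] at this; exact this)
        have h2 := geom_sum_mul (ω (y⁻¹ * x)) (n + 1)
        have h3 := teichmuller_pow_card_sub_one ω (mul_ne_zero (inv_ne_zero hy) hx)
        rw [hn, Nat.add_sub_cancel] at h3
        rw [h3, sub_self] at h2
        exact (mul_eq_zero.1 h2).resolve_right (sub_ne_zero.2 h1)
    have hkey : ∑ j ∈ Finset.range (n + 1), gaussSum (ω⁻¹ ^ j) ψ * ω x ^ j = u * ψ x := by
      simp only [gaussSum, Finset.sum_mul]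
      rw [Finset.sum_comm, Finset.sum_eq_single_of_mem x (Finset.mem_univ x)]
      · have := hgeom x hx
        rw [if_pos rfl] at this
        rw [← this, Finset.sum_mul]
        refine Finset.sum_congr rfl fun j _ => ?_
        have hxx : (ω⁻¹ ^ j) x = ω⁻¹ x ^ j := by
          rw [show x = ((Units.mk0 x hx : Fˣ) : F) from rfl, MulChar.pow_apply_coe]
        rw [hxx, MulChar.inv_apply', map_mul, mul_pow]
        ring
      · intro y _ hyx
        rcases eq_or_ne y 0 with rfl | hy
        · simp [MulChar.map_zero]
        have := hgeom y hy
        rw [if_neg hyx] at this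
        rw [← zero_mul (ψ y), ← this, Finset.sum_mul]
        refine Finset.sum_congr rfl fun j _ => ?_
        have hxx : (ω⁻¹ ^ j) y = ω⁻¹ y ^ j := by
          rw [show y = ((Units.mk0 y hy : Fˣ) : F) from rfl, MulChar.pow_apply_coe]
        rw [hxx, MulChar.inv_apply', map_mul, mul_pow]
        ring
    rw [Finset.sum_range_succ', pow_zero, pow_zero, gaussSum_one_left hψ1] at hkey
    refine u.isUnit.mul_left_cancel ?_
    rw [← hkey, hpow, mul_add, mul_add, Finset.mul_sum]
    simp only [← mul_assoc, Units.mul_inv, one_mul]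
    rw [hn, hun]
    push_cast
    ring

end Teichmuller

end GaussSums

/-! ### A valuation ring of `ℂ` above `p` carrying a Teichmüller character. -/

section TeichmullerLift

open IsLocalRing Polynomial

theorem ValuationSubring.mem_of_pow_eq_one {K : Type*} [Field K] (A : ValuationSubring K) {x : K}
    {n : ℕ} (hn : n ≠ 0) (hx : x ^ n = 1) : x ∈ A := by
  rw [← A.valuation_le_one_iff]
  refine le_of_eq (((pow_eq_one_iff ..).1 ?_).resolve_right hn)
  rw [← map_pow, hx, map_one]

theorem exists_valuationSubring_natCast_nonunit {p : ℕ} (hp : p.Prime) :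
    ∃ A : ValuationSubring ℂ, ¬ IsUnit (p : A) := by
  obtain ⟨B, hAB, hB⟩ := Ideal.image_subset_nonunits_valuationSubring
    (A := (Int.castRingHom ℂ).range) (Ideal.span {(p : (Int.castRingHom ℂ).range)}) (by
      rw [Ne, Ideal.span_singleton_eq_top]
      intro h
      obtain ⟨⟨_, n, rfl⟩, hn⟩ := isUnit_iff_exists_inv.1 h
      have h1 : ((p : ℤ) : ℂ) * (n : ℂ) = 1 := by simpa using congrArg Subtype.val hn
      have h2 : (p : ℤ) * n = 1 := by exact_mod_cast h1
      have h3 := Int.isUnit_iff.1 (IsUnit.of_mul_eq_one _ h2)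
      have := hp.one_lt
      omega)
  refine ⟨B, fun h => ?_⟩
  have h1 : (p : ℂ) ∈ B.nonunits := hB ⟨p, Ideal.mem_span_singleton_self _, by simp⟩
  rw [ValuationSubring.mem_nonunits_iff] at h1
  have h2 := (B.valuation_eq_one_iff _).1 h
  simp at h2
  exact h1.ne h2

theorem IsPrimitiveRoot.residue {R : Type*} [CommRing R] [IsDomain R] [IsLocalRing R] {n : ℕ}
    {z : R} (hz : IsPrimitiveRoot z n) (hn0 : n ≠ 0) (hn : IsUnit (n : R)) :
    IsPrimitiveRoot (IsLocalRing.residue R z) n := by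
  have h : ((n : ℕ) : ResidueField R) ≠ 0 := by
    rw [← map_natCast (IsLocalRing.residue R)]
    exact (residue_ne_zero_iff_isUnit _).2 hn
  have : NeZero ((n : ℕ) : ResidueField R) := ⟨h⟩
  rw [← isRoot_cyclotomic_iff, ← map_cyclotomic n (IsLocalRing.residue R)]
  exact (hz.isRoot_cyclotomic (Nat.pos_of_ne_zero hn0)).map

/-- `F` is a splitting field of `X ^ Q - X` over the prime field, and this polynomial already splits
in `κ`. -/
theorem FiniteField.exists_ringHom_of_isPrimitiveRoot {F κ : Type*} [Field F] [Fintype F] [Field κ]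
    {p : ℕ} [Fact p.Prime] [CharP F p] [CharP κ p] {z : κ}
    (hz : IsPrimitiveRoot z (Fintype.card F - 1)) : Nonempty (F →+* κ) := by
  let := ZMod.algebra F p
  let := ZMod.algebra κ p
  have hs : Splits (((X : (ZMod p)[X]) ^ Fintype.card F - X).map (algebraMap (ZMod p) κ)) := by
    have h1 : (X : κ[X]) ^ Fintype.card F - X = X * (X ^ (Fintype.card F - 1) - 1) := by
      rw [mul_sub, ← pow_succ', Nat.sub_add_cancel Fintype.card_pos, mul_one]
    rw [Polynomial.map_sub, Polynomial.map_pow, map_X, h1]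
    exact Splits.X.mul (X_pow_sub_one_splits hz)
  exact ⟨(IsSplittingField.lift F _ hs).toRingHom⟩

/-- There is a local domain of characteristic zero with a Teichmüller lift of `F` and a primitive
`p`-th root of unity. -/
theorem exists_teichmuller (F : Type*) [Field F] [Fintype F] (p : ℕ) [Fact p.Prime] [CharP F p] :
    ∃ A : ValuationSubring ℂ, ∃ (ι : F →+* ResidueField A) (ω : MulChar F A) (ζ : A),
      (∀ x, residue A (ω x) = ι x) ∧ IsPrimitiveRoot ζ p := by
  classical
  have hp := (Fact.out : p.Prime)
  obtain ⟨A, hA⟩ := exists_valuationSubring_natCast_nonunit hp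
  have hroot : ∀ n ≠ 0, ∃ z : A, IsPrimitiveRoot z n := fun n hn => by
    have h := Complex.isPrimitiveRoot_exp n hn
    refine ⟨⟨_, A.mem_of_pow_eq_one hn h.pow_eq_one⟩, ?_⟩
    exact IsPrimitiveRoot.coe_submonoidClass_iff.1 h
  obtain ⟨ζ, hζ⟩ := hroot p hp.ne_zero
  have hN0 : Fintype.card F - 1 ≠ 0 := by have := Fintype.one_lt_card (α := F); omega
  obtain ⟨z, hz⟩ := hroot _ hN0
  have hpκ : (p : ResidueField A) = 0 := by
    rw [← map_natCast (residue A)]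
    by_contra h
    exact hA ((residue_ne_zero_iff_isUnit _).1 h)
  have : CharP (ResidueField A) p := (CharP.charP_iff_prime_eq_zero hp).2 hpκ
  have hNu : IsUnit ((Fintype.card F - 1 : ℕ) : A) := by
    obtain ⟨n, -, hn⟩ := FiniteField.card F p
    rw [← residue_ne_zero_iff_isUnit, map_natCast, Nat.cast_sub Fintype.card_pos, hn,
      Nat.cast_pow, hpκ, zero_pow n.ne_zero]
    simp
  have hzκ := hz.residue hN0 hNu
  obtain ⟨ι⟩ := FiniteField.exists_ringHom_of_isPrimitiveRoot (F := F) (p := p) hzκ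
  obtain ⟨γ, hγ⟩ := IsCyclic.exists_generator (α := Fˣ)
  have : NeZero (Fintype.card F - 1) := ⟨hN0⟩
  obtain ⟨i, -, hi⟩ := hzκ.eq_pow_of_pow_eq_one (ξ := ι γ) (by
    rw [← map_pow, FiniteField.pow_card_sub_one_eq_one _ γ.ne_zero, map_one])
  let u : Aˣ := (hz.isUnit hN0).unit
  have hu : u ^ i ∈ rootsOfUnity (Fintype.card Fˣ) A := by
    rw [mem_rootsOfUnity, Fintype.card_units, ← pow_mul, mul_comm, pow_mul]
    have : u ^ (Fintype.card F - 1) = 1 := Units.ext (by simpa [u] using hz.pow_eq_one)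
    rw [this, one_pow]
  let ω : MulChar F A := MulChar.ofRootOfUnity hu hγ
  refine ⟨A, ι, ω, ζ, fun x => ?_, hζ⟩
  rcases eq_or_ne x 0 with rfl | hx
  · rw [MulChar.map_zero, map_zero, map_zero]
  obtain ⟨k, hk⟩ := mem_powers_iff_mem_zpowers.2 (hγ (Units.mk0 x hx))
  have hk' : x = (γ : F) ^ k := by
    have := congrArg Units.val hk
    simpa using this.symm
  have hωγ : ω γ = z ^ i := by
    have := MulChar.ofRootOfUnity_spec hu hγ
    simpa [u] using this
  rw [hk', map_pow, map_pow, map_pow, hωγ, map_pow, hi]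

end TeichmullerLift

/-! ### Divisibility of the exponential sum. -/

section ExponentialSums

open IsLocalRing

theorem AddChar.map_sum_eq_prod {A M ι : Type*} [AddCommMonoid A] [CommMonoid M] (ψ : AddChar A M)
    (s : Finset ι) (h : ι → A) : ψ (∑ i ∈ s, h i) = ∏ i ∈ s, ψ (h i) := by
  classical
  induction s using Finset.induction_on with
  | empty => simp
  | insert a s ha ih => rw [Finset.sum_insert ha, Finset.prod_insert ha, ψ.map_add_eq_mul, ih]

/-- Divisibility of the exponential sum of `s ^ g P(x)` for a homogeneous polynomial `P`. -/
theorem pow_dvd_sum_traceChar {F R σ : Type*} [Field F] [Fintype F] [CommRing R] [IsLocalRing R]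
    [IsDomain R] [Fintype σ] {ι : F →+* ResidueField R} {ω : MulChar F R} {p f : ℕ}
    [Fact p.Prime] [Algebra (ZMod p) F] {ζ : R} (hω : ∀ x, residue R (ω x) = ι x)
    (hζ : IsPrimitiveRoot ζ p) (hF : Fintype.card F = p ^ f) {d g W n : ℕ} (hd : 0 < d)
    {P : MvPolynomial σ F} (hP : P.IsHomogeneous d)
    (hW : ∀ B, g * Fintype.card σ ≤ d * B → W ≤ B)
    (hn : ∀ B, (p - 1) * f * W ≤ g * B → n ≤ B) [Fintype (σ → F)] :
    (ζ - 1) ^ n ∣ ∑ s : F, ∑ x : σ → F,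
      traceChar F hζ.pow_eq_one (s ^ g * MvPolynomial.eval x P) := by
  classical
  have hp := (Fact.out : p.Prime)
  have hf : f ≠ 0 := by
    rintro rfl
    have := Fintype.one_lt_card (α := F)
    rw [hF] at this
    simp at this
  obtain ⟨c, hc, hψ⟩ := exists_traceChar_eq_sum hω hζ hF
  set ψ := traceChar F hζ.pow_eq_one with hψdef
  set Q := Fintype.card F with hQ
  let E : (P.support → ℕ) → σ → ℕ := fun J v => ∑ a, J a * (a : σ →₀ ℕ) v
  -- `J` selects one power of `ω` from the expansion of `ψ` at each monomial of `P`; `E J v` is the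
  -- resulting exponent of `x v`.
  have hterm : ∀ (s : F) (x : σ → F), ψ (s ^ g * MvPolynomial.eval x P) =
      ∑ J ∈ Fintype.piFinset fun _ : P.support => Finset.range Q,
        (∏ a, c (J a) * ω (P.coeff a) ^ J a) * (ω s ^ (g * ∑ a, J a) * ∏ v, ω (x v) ^ E J v) := by
    intro s x
    rw [MvPolynomial.eval_eq', Finset.mul_sum, AddChar.map_sum_eq_prod, ← Finset.prod_coe_sort,
      Finset.prod_congr rfl fun a _ => hψ _, Finset.prod_univ_sum]
    refine Finset.sum_congr rfl fun J _ => ?_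
    simp only [map_mul, map_prod, map_pow, mul_pow, Finset.prod_mul_distrib, E]
    have h1 : ∏ a, (ω s ^ g) ^ J a = ω s ^ (g * ∑ a, J a) := by
      rw [Finset.prod_pow_eq_pow_sum, ← pow_mul]
    have h2 : ∏ a : P.support, (∏ v, ω (x v) ^ (a : σ →₀ ℕ) v) ^ J a =
        ∏ v, ω (x v) ^ ∑ a, J a * (a : σ →₀ ℕ) v := by
      simp only [← Finset.prod_pow]
      rw [Finset.prod_comm]
      refine Finset.prod_congr rfl fun v _ => ?_
      rw [← Finset.prod_pow_eq_pow_sum]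
      exact Finset.prod_congr rfl fun a _ => by rw [← pow_mul, mul_comm]
    rw [h1, h2]
    ring
  have hsum : ∑ s : F, ∑ x : σ → F, ψ (s ^ g * MvPolynomial.eval x P) =
      ∑ J ∈ Fintype.piFinset fun _ : P.support => Finset.range Q,
        (∏ a, c (J a) * ω (P.coeff a) ^ J a) *
          ((∑ s, ω s ^ (g * ∑ a, J a)) * ∏ v, ∑ y, ω y ^ E J v) := by
    simp only [hterm]
    have hswap : ∀ s : F, ∑ x : σ → F, ∑ J ∈ Fintype.piFinset fun _ : P.support => Finset.range Q,
        (∏ a, c (J a) * ω (P.coeff a) ^ J a) * (ω s ^ (g * ∑ a, J a) * ∏ v, ω (x v) ^ E J v) =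
        ∑ J ∈ Fintype.piFinset fun _ : P.support => Finset.range Q,
        (∏ a, c (J a) * ω (P.coeff a) ^ J a) *
          (ω s ^ (g * ∑ a, J a) * ∏ v, ∑ y, ω y ^ E J v) := fun s => by
      rw [Finset.sum_comm]
      refine Finset.sum_congr rfl fun J _ => ?_
      rw [Finset.prod_univ_sum, ← Finset.mul_sum, ← Finset.mul_sum]
      congr 2
      refine Finset.sum_congr ?_ fun _ _ => rfl
      ext; simp
    simp only [hswap]
    rw [Finset.sum_comm]
    refine Finset.sum_congr rfl fun J _ => ?_
    rw [← Finset.mul_sum, ← Finset.sum_mul]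
  rw [hsum]
  refine Finset.dvd_sum fun J hJ => ?_
  have hJ' : ∀ a, J a < Q := fun a => Finset.mem_range.1 (Fintype.mem_piFinset.1 hJ a)
  by_cases hs : Q - 1 ∣ g * ∑ a, J a
  swap
  · rw [teichmuller_sum_pow hω hs, zero_mul, mul_zero]
    exact dvd_zero _
  by_cases hv : ∀ v, Q - 1 ∣ E J v
  swap
  · push Not at hv
    obtain ⟨v, hv⟩ := hv
    rw [Finset.prod_eq_zero (Finset.mem_univ v) (teichmuller_sum_pow hω hv), mul_zero, mul_zero]
    exact dvd_zero _
  rw [hF] at hs hv hJ'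
  have hweight := hn _ (mul_le_mul_sum_digits hp.one_lt hf hd Finset.univ J (fun a _ => hJ' a)
    (fun a v => (a : σ →₀ ℕ) v)
    (fun a _ => by
      have := hP (MvPolynomial.mem_support_iff.1 a.2)
      rw [Finsupp.weight_apply, Finsupp.sum_fintype _ _ (by simp)] at this
      simpa using this) hs hv hW)
  refine (pow_dvd_pow _ hweight).trans ?_
  rw [pow_add]
  refine mul_dvd_mul ?_ (Dvd.dvd.mul_left ?_ _)
  · rw [← Finset.prod_pow_eq_pow_sum]
    exact Finset.prod_dvd_prod_of_dvd _ _ fun a _ => (hc _ (by rw [hF]; exact hJ' a)).mul_right _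
  · rw [pow_mul, ← Finset.prod_const, mul_comm (p - 1)]
    refine (Finset.prod_dvd_prod_of_dvd _ (fun v => ∑ y, ω y ^ E J v) fun v hv0 => ?_).trans
      (Finset.prod_dvd_prod_of_subset _ _ _ (Finset.filter_subset _ _))
    -- With exponent `0` every `y`, including `y = 0`, contributes `1`, so the factor is `Q`. These
    -- factors supply the `V.card` term of the weight bound.
    have h0 : E J v = 0 := (Finset.mem_filter.1 hv0).2
    simp only [h0, pow_zero, Finset.sum_const, Finset.card_univ, nsmul_eq_mul, mul_one]
    exact (associated_sub_one_pow_card hζ hF).dvd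

end ExponentialSums

/-! ### Sums over power maps on finite abelian groups. -/

/-- In a cyclic group of order `M * r` the `M`-th power map has the `r`-torsion as image, by
comparing orders, and all its fibres have `M` elements. -/
theorem sum_pow_eq_nsmul_sum_of_isCyclic {G A : Type*} [CommGroup G] [IsCyclic G] [Fintype G]
    [DecidableEq G] [AddCommMonoid A] {M r : ℕ} (hM : M * r = Fintype.card G) (h : G → A) :
    ∑ u, h (u ^ M) = M • ∑ t with t ^ r = 1, h t := by
  have hpos : 0 < M * r := hM ▸ Fintype.card_pos
  have hker : (Finset.univ.filter fun u : G => u ^ M = 1).card = M := by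
    have h1 := IsCyclic.card_powMonoidHom_ker G M
    rw [Nat.card_eq_fintype_card (α := G), ← hM, Nat.gcd_comm, Nat.gcd_mul_right_right] at h1
    conv_rhs => rw [← h1, Nat.card_eq_fintype_card, Fintype.card_subtype]
    simp [MonoidHom.mem_ker]
  have hran : ∀ t : G, t ^ r = 1 → t ∈ Set.range (powMonoidHom M : G →* G) := by
    have h1 := IsCyclic.card_powMonoidHom_range G M
    have h2 := IsCyclic.card_powMonoidHom_ker G r
    rw [Nat.card_eq_fintype_card (α := G), ← hM] at h1 h2
    rw [Nat.gcd_comm, Nat.gcd_mul_right_right, Nat.mul_div_cancel_left _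
      (Nat.pos_of_mul_pos_right hpos)] at h1
    rw [Nat.gcd_comm, Nat.gcd_mul_left_right] at h2
    have hle : (powMonoidHom M : G →* G).range ≤ (powMonoidHom r : G →* G).ker := by
      rintro _ ⟨u, rfl⟩
      rw [MonoidHom.mem_ker, powMonoidHom_apply, powMonoidHom_apply, ← pow_mul, hM,
        pow_card_eq_one]
    have heq := Subgroup.eq_of_le_of_card_ge hle (by rw [h1, h2])
    intro t ht
    have : t ∈ (powMonoidHom r : G →* G).ker := by rwa [MonoidHom.mem_ker, powMonoidHom_apply]
    rwa [← heq] at this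
  rw [← Finset.sum_fiberwise_of_maps_to (s := Finset.univ)
    (t := Finset.univ.filter fun t : G => t ^ r = 1) (g := fun u => u ^ M)
    (fun u _ => by simp [← pow_mul, hM]), Finset.smul_sum]
  refine Finset.sum_congr rfl fun t ht => ?_
  rw [Finset.sum_congr rfl fun u hu => by rw [(Finset.mem_filter.1 hu).2], Finset.sum_const]
  congr 1
  refine Eq.trans ?_ hker
  exact MonoidHom.card_fiber_eq_of_mem_range (powMonoidHom M : G →* G)
    (hran t (Finset.mem_filter.1 ht).2) ⟨1, map_one _⟩

/-- A sum over `M`-th powers of a function invariant under `d`-th powers is a sum over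
`gcd d M`-th powers. -/
theorem sum_pow_eq_sum_pow_gcd {G R : Type*} [CommGroup G] [Fintype G] [CommRing R] [IsDomain R]
    [CharZero R] {d M : ℕ} (hd : 0 < d) (h : G → R) (hh : ∀ t v, h (t * v ^ d) = h t) :
    ∑ u, h (u ^ M) = ∑ u, h (u ^ Nat.gcd d M) := by
  set g := Nat.gcd d M with hg
  have hgpos : 0 < g := Nat.gcd_pos_of_pos_left _ hd
  obtain ⟨d', hd'⟩ : g ∣ d := Nat.gcd_dvd_left _ _
  obtain ⟨M', hM'⟩ : g ∣ M := Nat.gcd_dvd_right _ _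
  obtain ⟨α, β, hαβ⟩ : ∃ α β : ℤ, α * M' + β * d' = 1 := by
    have h1 := Nat.gcd_eq_gcd_ab d M
    rw [← hg] at h1
    refine ⟨Nat.gcdB d M, Nat.gcdA d M, ?_⟩
    have hg0 : (g : ℤ) ≠ 0 := by exact_mod_cast hgpos.ne'
    refine mul_left_cancel₀ hg0 ?_
    have h2 : (d : ℤ) = g * d' := by exact_mod_cast hd'
    have h3 : (M : ℤ) = g * M' := by exact_mod_cast hM'
    calc (g : ℤ) * (Nat.gcdB d M * M' + Nat.gcdA d M * d')
        = g * d' * Nat.gcdA d M + g * M' * Nat.gcdB d M := by ring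
      _ = g * 1 := by rw [← h2, ← h3, ← h1, mul_one]
  -- After averaging over `v`, the argument `u ^ M * v ^ d` is the `g`-th power of `u ^ M' * v ^
  -- d'`. The Bézout relation completes this to a determinant-one change of variables.
  let e : G × G ≃ G × G :=
    { toFun := fun x => (x.1 ^ (M' : ℤ) * x.2 ^ (d' : ℤ), x.1 ^ (-β) * x.2 ^ α)
      invFun := fun x => (x.1 ^ α * x.2 ^ (-(d' : ℤ)), x.1 ^ β * x.2 ^ (M' : ℤ))
      left_inv := fun x => by
        refine Prod.ext ?_ ?_
        · simp only [mul_zpow, ← zpow_mul]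
          rw [mul_mul_mul_comm, ← zpow_add, ← zpow_add,
            show (M' : ℤ) * α + -β * -d' = 1 by linarith, show (d' : ℤ) * α + α * -d' = 0 by ring]
          simp
        · simp only [mul_zpow, ← zpow_mul]
          rw [mul_mul_mul_comm, ← zpow_add, ← zpow_add,
            show (M' : ℤ) * β + -β * M' = 0 by ring, show (d' : ℤ) * β + α * M' = 1 by linarith]
          simp
      right_inv := fun x => by
        refine Prod.ext ?_ ?_
        · simp only [mul_zpow, ← zpow_mul]
          rw [mul_mul_mul_comm, ← zpow_add, ← zpow_add,
            show α * M' + β * d' = 1 from hαβ, show -(d' : ℤ) * M' + M' * d' = 0 by ring]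
          simp
        · simp only [mul_zpow, ← zpow_mul]
          rw [mul_mul_mul_comm, ← zpow_add, ← zpow_add,
            show α * -β + β * α = 0 by ring, show -(d' : ℤ) * -β + M' * α = 1 by linarith]
          simp }
  have hcard : (Fintype.card G : R) ≠ 0 := Nat.cast_ne_zero.2 Fintype.card_ne_zero
  refine mul_left_cancel₀ hcard ?_
  have h1 : (Fintype.card G : R) * ∑ u, h (u ^ M) = ∑ x : G × G, h ((e x).1 ^ g) := by
    rw [Fintype.sum_prod_type_right, ← nsmul_eq_mul, ← Finset.card_univ, ← Finset.sum_const]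
    refine Finset.sum_congr rfl fun v _ => Finset.sum_congr rfl fun u _ => ?_
    rw [← hh _ v]
    congr 1
    simp only [e, Equiv.coe_fn_mk, zpow_natCast, mul_pow, ← pow_mul]
    rw [hM', hd', mul_comm g, mul_comm g]
  rw [h1, e.sum_comp fun x => h (x.1 ^ g), Fintype.sum_prod_type_right, ← nsmul_eq_mul,
    ← Finset.card_univ, ← Finset.sum_const]

theorem eval_smul_of_isHomogeneous {F σ : Type*} [CommRing F] [Fintype σ] {P : MvPolynomial σ F}
    {d : ℕ} (hP : P.IsHomogeneous d) (c : F) (x : σ → F) :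
    MvPolynomial.eval (c • x) P = c ^ d * MvPolynomial.eval x P := by
  rw [MvPolynomial.eval_eq', MvPolynomial.eval_eq', Finset.mul_sum]
  refine Finset.sum_congr rfl fun a ha => ?_
  have h := hP (MvPolynomial.mem_support_iff.1 ha)
  rw [Finsupp.weight_apply, Finsupp.sum_fintype _ _ (by simp)] at h
  simp only [Pi.one_apply, smul_eq_mul, mul_one] at h
  simp only [Pi.smul_apply, smul_eq_mul, mul_pow, Finset.prod_mul_distrib,
    Finset.prod_pow_eq_pow_sum, h]
  ring

/-! ### From point counts to exponential sums. -/

section Count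

variable {F R : Type*} [Field F] [Fintype F] [CommRing R] [IsDomain R] [CharZero R] {k : ℕ}

/-- The number of points of an Artin–Schreier hypersurface as a sum of exponential sums. -/
theorem artinSchreierCount_eq_sum [DecidableEq F] {ψ : AddChar F R} (hψ : ψ.IsPrimitive) {q : ℕ}
    (hinj : Function.Injective fun y : F => y ^ q) (hψq : ∀ x, ψ (x ^ q) = ψ x)
    (P : MvPolynomial (Fin k) F) :
    (artinSchreierCount q P : R) =
      ∑ t with t ^ q = t, ∑ x : Fin k → F, ψ (t * MvPolynomial.eval x P) := by
  have hQ : (Fintype.card F : R) ≠ 0 := Nat.cast_ne_zero.2 Fintype.card_ne_zero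
  refine mul_left_cancel₀ hQ ?_
  let fr : F ≃ F := Equiv.ofBijective _ (Finite.injective_iff_bijective.1 hinj)
  have hinner : ∀ t : F, ∑ y : F, ψ (t * (y - y ^ q)) =
      if t ^ q = t then (Fintype.card F : R) else 0 := fun t => by
    -- Invariance of `ψ` under `q`-th powers replaces `t y` by `t ^ q y ^ q`, making the argument
    -- linear in `y ^ q`; only `t ^ q = t` survives.
    have h1 : ∀ y : F, ψ (t * (y - y ^ q)) = ψ (fr y * (t ^ q - t)) := fun y => by
      rw [mul_sub, sub_eq_add_neg, ψ.map_add_eq_mul, ← hψq (t * y), ← ψ.map_add_eq_mul]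
      congr 1
      simp only [fr, Equiv.ofBijective_apply, mul_pow]
      ring
    rw [Finset.sum_congr rfl fun y _ => h1 y, fr.sum_comp fun y => ψ (y * (t ^ q - t)),
      AddChar.sum_mulShift _ hψ]
    simp [sub_eq_zero]
  have hN : (artinSchreierCount q P : R) = ∑ x : Fin k → F, ∑ y : F,
      if MvPolynomial.eval x P - (y ^ q - y) = 0 then 1 else 0 := by
    rw [artinSchreierCount, Nat.card_eq_fintype_card, Fintype.card_subtype, Finset.card_filter,
      Fintype.sum_prod_type]
    simp [sub_eq_zero]
  have hite : ∀ b : F, (Fintype.card F : R) * (if b = 0 then 1 else 0) = ∑ t, ψ (t * b) :=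
    fun b => by rw [AddChar.sum_mulShift _ hψ]; simp
  rw [hN]
  simp only [Finset.mul_sum, hite]
  calc ∑ x : Fin k → F, ∑ y, ∑ t, ψ (t * (MvPolynomial.eval x P - (y ^ q - y)))
      = ∑ x : Fin k → F, ∑ t, ψ (t * MvPolynomial.eval x P) * ∑ y, ψ (t * (y - y ^ q)) := by
        refine Finset.sum_congr rfl fun x _ => ?_
        rw [Finset.sum_comm]
        refine Finset.sum_congr rfl fun t _ => ?_
        rw [Finset.mul_sum]
        refine Finset.sum_congr rfl fun y _ => ?_
        rw [← ψ.map_add_eq_mul]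
        congr 1
        ring
    _ = _ := by
        rw [Finset.sum_comm, Finset.sum_filter]
        refine Finset.sum_congr rfl fun t _ => ?_
        rw [hinner]
        split_ifs
        · exact Finset.sum_congr rfl fun x _ => mul_comm _ _
        · simp

theorem mul_artinSchreierCount_add {ψ : AddChar F R} (hψ : ψ.IsPrimitive) {q d M : ℕ}
    (hinj : Function.Injective fun y : F => y ^ q) (hψq : ∀ x, ψ (x ^ q) = ψ x) (hd : 0 < d)
    (hq : 1 < q) (hM : M * (q - 1) = Fintype.card F - 1) {P : MvPolynomial (Fin k) F}
    (hP : P.IsHomogeneous d) :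
    (M : R) * artinSchreierCount q P + (Fintype.card F : R) ^ k =
      M * (Fintype.card F : R) ^ k +
        ∑ s : F, ∑ x : Fin k → F, ψ (s ^ Nat.gcd d M * MvPolynomial.eval x P) := by
  classical
  rw [artinSchreierCount_eq_sum hψ hinj hψq]
  let S : F → R := fun t => ∑ x : Fin k → F, ψ (t * MvPolynomial.eval x P)
  have hS0 : S 0 = (Fintype.card F : R) ^ k := by simp [S]
  -- Homogeneity lets `v ^ d` be absorbed by the substitution `x ↦ v • x`.
  have hinv : ∀ t v : Fˣ, S ((t * v ^ d : Fˣ) : F) = S t := fun t v => by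
    let e : (Fin k → F) ≃ (Fin k → F) := MulAction.toPerm v
    simp only [S]
    rw [← e.sum_comp fun x => ψ (t * MvPolynomial.eval x P)]
    refine Finset.sum_congr rfl fun x _ => ?_
    have he : e x = (v : F) • x := rfl
    rw [he, eval_smul_of_isHomogeneous hP]
    congr 1
    push_cast
    ring
  have hgpos : Nat.gcd d M ≠ 0 := (Nat.gcd_pos_of_pos_left _ hd).ne'
  have hsplit : ∀ h : F → R, ∑ x, h x = h 0 + ∑ u : Fˣ, h u := fun h => by
    have := sum_units (h := fun x => if x = 0 then 0 else h x) (by simp)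
    simp only [Units.ne_zero, if_false] at this
    rw [this, Finset.sum_ite, Finset.sum_const_zero, zero_add,
      ← Finset.add_sum_erase _ _ (Finset.mem_univ (0 : F))]
    congr 2
    ext; simp
  have h1 : ∑ t with t ^ q = t, S t = S 0 + ∑ u : Fˣ with u ^ (q - 1) = 1, S u := by
    rw [Finset.sum_filter, hsplit, if_pos (zero_pow (by omega)), Finset.sum_filter]
    congr 1
    refine Finset.sum_congr rfl fun u _ => ?_
    congr 1
    obtain ⟨r, rfl⟩ : ∃ r, q = r + 1 := ⟨q - 1, by omega⟩
    rw [Nat.add_sub_cancel, pow_succ, mul_eq_right₀ u.ne_zero, Units.ext_iff]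
    simp
  have h2 := sum_pow_eq_nsmul_sum_of_isCyclic (G := Fˣ) (M := M) (r := q - 1)
    (by rw [hM, Fintype.card_units]) (fun u => S u)
  have h3 := sum_pow_eq_sum_pow_gcd (G := Fˣ) (M := M) hd (fun u => S u) hinv
  have h4 : ∑ s : F, S (s ^ Nat.gcd d M) = S 0 + ∑ u : Fˣ, S ((u ^ Nat.gcd d M : Fˣ) : F) := by
    rw [hsplit, zero_pow hgpos]
    simp
  change (M : R) * ∑ t with t ^ q = t, S t + _ = _ + ∑ s : F, S (s ^ Nat.gcd d M)
  rw [h4, ← h3, h2, h1, nsmul_eq_mul, hS0]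
  ring

end Count

/-! ### The lower bound, and the relation to zeros when `g = 1`. -/

section LowerBound

open IsLocalRing

theorem le_mul_padicValNat_of_pow_dvd {R : Type*} [CommRing R] [IsDomain R] [IsLocalRing R]
    {p n z : ℕ} [Fact p.Prime] {ζ : R} (hζ : IsPrimitiveRoot ζ p) (hp : residue R (p : R) = 0)
    (hz : z ≠ 0) (h : (ζ - 1) ^ n ∣ (z : R)) : n ≤ (p - 1) * padicValNat p z := by
  have hpp := (Fact.out : p.Prime)
  have hchar : CharP (ResidueField R) p :=
    (CharP.charP_iff_prime_eq_zero hpp).2 (by rwa [map_natCast] at hp)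
  obtain ⟨u, hu⟩ : p ^ padicValNat p z ∣ z := pow_padicValNat_dvd
  have hpu : ¬ p ∣ u := fun ⟨w, hw⟩ => by
    refine pow_succ_padicValNat_not_dvd (p := p) hz ⟨w, ?_⟩
    conv_lhs => rw [hu, hw]
    ring
  have hunit : IsUnit (u : R) := by
    rw [← residue_ne_zero_iff_isUnit, map_natCast, Ne, CharP.cast_eq_zero_iff _ p]
    exact hpu
  have hne : ζ - 1 ≠ 0 := sub_ne_zero.2 (hζ.ne_one hpp.one_lt)
  have hnu : ¬ IsUnit (ζ - 1) := fun hunit' => by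
    have h1 : IsUnit (p : R) := hζ.associated_sub_one_pow.isUnit (hunit'.pow _)
    exact (residue_ne_zero_iff_isUnit _).2 h1 hp
  rw [hu, Nat.cast_mul, hunit.dvd_mul_right, Nat.cast_pow] at h
  have h2 := h.trans (hζ.associated_sub_one_pow.symm.pow_pow (n := padicValNat p z)).dvd
  rwa [← pow_mul, pow_dvd_pow_iff hne hnu] at h2

theorem artinSchreierCount_ne_zero {F : Type*} [Field F] [Finite F] {k q d : ℕ} (hq : q ≠ 0)
    (hd : d ≠ 0) {P : MvPolynomial (Fin k) F} (hP : P.IsHomogeneous d) :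
    artinSchreierCount q P ≠ 0 := by
  have h0 := eval_smul_of_isHomogeneous hP 0 0
  rw [zero_pow hd, zero_mul, zero_smul] at h0
  have : Nonempty {v : (Fin k → F) × F // MvPolynomial.eval v.1 P = v.2 ^ q - v.2} :=
    ⟨⟨(0, 0), by rw [h0, zero_pow hq, sub_zero]⟩⟩
  exact Nat.card_pos.ne'

theorem not_dvd_of_mul_eq_pow_sub_one {p M r f : ℕ} (hp : p.Prime) (hf : f ≠ 0)
    (h : M * r = p ^ f - 1) : ¬ p ∣ M := fun hM => by
  have h1 : p ∣ p ^ f - 1 := h ▸ hM.mul_right r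
  have h2 : p ∣ p ^ f := dvd_pow_self _ hf
  have h3 : 1 ≤ p ^ f := Nat.one_le_pow _ _ hp.pos
  have h4 := (Nat.dvd_sub h2 h1)
  rw [Nat.sub_sub_self h3] at h4
  exact hp.one_lt.ne' (Nat.dvd_one.1 h4)

variable {F : Type*} [Field F] [Fintype F] {p e f q k d M : ℕ}

theorem exists_primitive_pow_invariant_char (hp : p.Prime) [CharP F p] (hq : q = p ^ e) :
    ∃ ψ : AddChar F ℂ, ψ.IsPrimitive ∧ (∀ x, ψ (x ^ q) = ψ x) ∧
      Function.Injective fun y : F => y ^ q := by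
  have : Fact p.Prime := ⟨hp⟩
  have : ExpChar F p := ExpChar.prime hp
  let := ZMod.algebra F p
  refine ⟨_, traceChar_isPrimitive (Complex.isPrimitiveRoot_exp p hp.ne_zero), fun x => ?_, ?_⟩
  · rw [hq, traceChar_pow_char_pow]
  · rw [hq]
    exact (iterateFrobenius F p e).injective

/-- Lower bound for the valuation of the number of points of an Artin–Schreier hypersurface. -/
theorem mul_le_gcd_mul_padicValNat (hp : p.Prime) (hq : q = p ^ e) (he : e ≠ 0)
    (hF : Fintype.card F = p ^ f) (hf : f ≠ 0) (hd : 0 < d)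
    (hM : M * (q - 1) = Fintype.card F - 1) {P : MvPolynomial (Fin k) F} (hP : P.IsHomogeneous d)
    {W : ℕ} (hW : ∀ B, Nat.gcd d M * k ≤ d * B → W ≤ B) :
    f * W ≤ Nat.gcd d M * padicValNat p (artinSchreierCount q P) := by
  have : Fact p.Prime := ⟨hp⟩
  have hchar : CharP F p := by
    rw [CharP.charP_iff_prime_eq_zero hp]
    have h := FiniteField.cast_card_eq_zero F
    rw [hF, Nat.cast_pow] at h
    exact pow_eq_zero_iff hf |>.1 h
  let := ZMod.algebra F p
  have : ExpChar F p := ExpChar.prime hp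
  have hq1 : 1 < q := hq ▸ Nat.one_lt_pow he hp.one_lt
  obtain ⟨A, ι, ω, ζ, hω, hζ⟩ := exists_teichmuller F p
  set g := Nat.gcd d M with hg
  have hgpos : 0 < g := Nat.gcd_pos_of_pos_left _ hd
  -- Rounding up costs nothing: `n ≤ (p - 1) v` is equivalent to `(p - 1) f W ≤ g (p - 1) v`.
  set n := ((p - 1) * f * W) ⌈/⌉ g with hn
  have hnle : ∀ B, (p - 1) * f * W ≤ g * B → n ≤ B := fun B hB =>
    (ceilDiv_le_iff_le_mul hgpos).2 hB
  have hT := pow_dvd_sum_traceChar hω hζ hF hd hP (g := g) (W := W) (n := n)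
    (by simpa using hW) hnle
  have hrel := mul_artinSchreierCount_add (R := A) (traceChar_isPrimitive (F := F) hζ) (q := q)
    (by rw [hq]; exact (iterateFrobenius F p e).injective)
    (fun x => by rw [hq, traceChar_pow_char_pow]) hd hq1 hM hP
  have hWk : W ≤ g * k := hW _ (Nat.le_mul_of_pos_left _ hd)
  have hQ : (ζ - 1) ^ n ∣ (Fintype.card F : A) ^ k := by
    have h1 : n ≤ f * (p - 1) * k := hnle _ (by
      calc (p - 1) * f * W ≤ (p - 1) * f * (g * k) := Nat.mul_le_mul_left _ hWk
        _ = g * (f * (p - 1) * k) := by ring)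
    refine (pow_dvd_pow _ h1).trans ?_
    rw [pow_mul]
    exact (associated_sub_one_pow_card hζ hF).pow_pow.dvd
  have hMN : (ζ - 1) ^ n ∣ ((M * artinSchreierCount q P : ℕ) : A) := by
    rw [Nat.cast_mul]
    refine (dvd_add_left hQ).1 ?_
    rw [hrel]
    exact dvd_add (hQ.mul_left _) hT
  have hpM := not_dvd_of_mul_eq_pow_sub_one hp hf (hF ▸ hM)
  have hM0 : M ≠ 0 := by rintro rfl; simp at hpM
  have hN0 := artinSchreierCount_ne_zero (q := q) (by omega) hd.ne' hP
  have hle := le_mul_padicValNat_of_pow_dvd hζ (natCast_residue_eq_zero p ι)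
    (mul_ne_zero hM0 hN0) hMN
  rw [padicValNat.mul hM0 hN0, padicValNat.eq_zero_of_not_dvd hpM, zero_add,
    hn, ceilDiv_le_iff_le_mul hgpos] at hle
  refine Nat.le_of_mul_le_mul_left ?_ (Nat.sub_pos_of_lt hp.one_lt)
  calc (p - 1) * (f * W) = (p - 1) * f * W := by ring
    _ ≤ _ := hle
    _ = _ := by ring

/-- If `d` is coprime to `(#F - 1) / (q - 1)`, the number of points of an Artin–Schreier
hypersurface is determined by the number of zeros of the polynomial. -/
theorem mul_artinSchreierCount_add_of_coprime (hp : p.Prime) [CharP F p] (hq : q = p ^ e)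
    (he : e ≠ 0) (hd : 0 < d) (hM : M * (q - 1) = Fintype.card F - 1) (hcop : Nat.gcd d M = 1)
    {P : MvPolynomial (Fin k) F} (hP : P.IsHomogeneous d) :
    M * artinSchreierCount q P + Fintype.card F ^ k = M * Fintype.card F ^ k +
      Fintype.card F * Nat.card {x : Fin k → F // MvPolynomial.eval x P = 0} := by
  classical
  obtain ⟨ψ, hψ, hψq, hinj⟩ := exists_primitive_pow_invariant_char (F := F) hp hq
  have hq1 : 1 < q := hq ▸ Nat.one_lt_pow he hp.one_lt
  have hrel := mul_artinSchreierCount_add hψ hinj hψq hd hq1 hM hP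
  rw [hcop, Finset.sum_comm] at hrel
  -- With `g = 1` the sum over `s` runs over a full additive character and detects `P(x) = 0`.
  have hz : ∑ x : Fin k → F, ∑ s : F, ψ (s ^ 1 * MvPolynomial.eval x P) =
      (Fintype.card F * Nat.card {x : Fin k → F // MvPolynomial.eval x P = 0} : ℕ) := by
    simp only [pow_one, AddChar.sum_mulShift _ hψ]
    rw [Nat.card_eq_fintype_card, Fintype.card_subtype, Finset.card_filter, Finset.mul_sum]
    push_cast
    simp
  rw [hz] at hrel
  exact_mod_cast hrel

end LowerBound

/-! ### Homogeneous polynomials with minimally divisible zero counts. -/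

section Sharpness

open MvPolynomial

variable {F : Type*} [Field F]

theorem sum_ite_prod_eq_zero [Fintype F] [DecidableEq F] (n a b : ℕ) :
    ∃ u, u + (Fintype.card F - 1) ^ n = Fintype.card F ^ n ∧
      ∑ y : Fin n → F, (if ∏ i, y i = 0 then a else b) =
        u * a + (Fintype.card F - 1) ^ n * b := by
  have h1 : (Finset.univ.filter fun y : Fin n → F => ¬ ∏ i, y i = 0).card =
      (Fintype.card F - 1) ^ n := by
    have : (Finset.univ.filter fun y : Fin n → F => ¬ ∏ i, y i = 0) =
        Fintype.piFinset fun _ => Finset.univ.erase 0 := by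
      ext y
      simp [Finset.prod_eq_zero_iff]
    rw [this, Fintype.card_piFinset]
    simp
  refine ⟨(Finset.univ.filter fun y : Fin n → F => ∏ i, y i = 0).card, ?_, ?_⟩
  · rw [← h1, Finset.card_filter_add_card_filter_not]
    simp
  · rw [Finset.sum_ite, Finset.sum_const, Finset.sum_const, h1, smul_eq_mul, smul_eq_mul]

theorem natCard_zeros_eq_sum {σ : Type*} [Fintype (σ → F)] [DecidableEq F]
    (P : MvPolynomial σ F) :
    Nat.card {x : σ → F // eval x P = 0} = ∑ x : σ → F, if eval x P = 0 then 1 else 0 := by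
  rw [Nat.card_eq_fintype_card, Fintype.card_subtype, Finset.card_filter]

theorem natCard_zeros_rename {σ τ : Type*} (e : σ ≃ τ) (P : MvPolynomial σ F) :
    Nat.card {x : τ → F // eval x (rename e P) = 0} = Nat.card {x : σ → F // eval x P = 0} :=
  Nat.card_congr ((e.symm.arrowCongr (Equiv.refl F)).subtypeEquiv fun x => by
    rw [eval_rename]; rfl)

/-- Adding a product of `n + 1` new variables to a polynomial. -/
noncomputable def addProd {τ : Type*} (n : ℕ) (P : MvPolynomial τ F) :
    MvPolynomial (Option (Fin n ⊕ τ)) F :=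
  X none * ∏ i : Fin n, X (some (Sum.inl i)) + rename (fun j => some (Sum.inr j)) P

theorem addProd_isHomogeneous {τ : Type*} (n : ℕ) {P : MvPolynomial τ F}
    (hP : P.IsHomogeneous (n + 1)) : (addProd n P).IsHomogeneous (n + 1) := by
  refine IsHomogeneous.add ?_ hP.rename_isHomogeneous
  have h := IsHomogeneous.prod Finset.univ
    (fun i : Fin n => (X (some (Sum.inl i)) : MvPolynomial (Option (Fin n ⊕ τ)) F)) (fun _ => 1)
    fun i _ => isHomogeneous_X F _
  have h2 := (isHomogeneous_X F (none : Option (Fin n ⊕ τ))).mul h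
  simpa [add_comm] using h2

/-- If the other `n` new variables have nonzero product, the first new variable is determined;
otherwise it is free and `P` must vanish. -/
theorem natCard_zeros_addProd [Fintype F] {τ : Type*} [Fintype τ] (n : ℕ) (P : MvPolynomial τ F) :
    ∃ u, u + (Fintype.card F - 1) ^ n = Fintype.card F ^ n ∧
      Nat.card {x // eval x (addProd n P) = 0} =
        u * (Fintype.card F * Nat.card {x : τ → F // eval x P = 0}) +
          (Fintype.card F - 1) ^ n * Fintype.card F ^ Fintype.card τ := by
  classical
  let e : (Option (Fin n ⊕ τ) → F) ≃ F × ((Fin n → F) × (τ → F)) :=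
    (Equiv.piOptionEquivProd (β := fun _ => F)).trans
      ((Equiv.refl F).prodCongr (Equiv.sumArrowEquivProdArrow _ _ _))
  have heval : ∀ w, eval w (addProd n P) =
      (e w).1 * ∏ i, (e w).2.1 i + eval (e w).2.2 P := fun w => by
    simp only [addProd, map_add, map_mul, eval_X, map_prod, eval_rename]
    rfl
  have hinner : ∀ Y b : F, ∑ z : F, (if z * Y + b = 0 then 1 else 0) =
      if Y = 0 then Fintype.card F * (if b = 0 then 1 else 0) else 1 := fun Y b => by
    split_ifs with hY hb
    · simp [hY, hb]
    · simp [hY, hb]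
    · have : ∀ z, z * Y + b = 0 ↔ z = -b / Y := fun z => by
        rw [eq_div_iff hY, ← add_eq_zero_iff_eq_neg]
      simp [this]
  obtain ⟨u, hu, hsum⟩ := sum_ite_prod_eq_zero (F := F) n
    (Fintype.card F * Nat.card {x : τ → F // eval x P = 0}) (Fintype.card F ^ Fintype.card τ)
  refine ⟨u, hu, ?_⟩
  rw [← hsum, natCard_zeros_eq_sum]
  simp only [heval]
  rw [e.sum_comp fun z => if z.1 * ∏ i, z.2.1 i + eval z.2.2 P = 0 then 1 else 0,
    Fintype.sum_prod_type_right, Fintype.sum_prod_type]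
  refine Finset.sum_congr rfl fun y _ => ?_
  simp only [hinner]
  split_ifs with h
  · rw [← Finset.mul_sum, natCard_zeros_eq_sum]
  · simp

/-- There are homogeneous polynomials for which the number of zeros is no more divisible than
Ax's theorem requires. -/
theorem exists_isHomogeneous_natCard_zeros [Fintype F] {p : ℕ} (hp : p.Prime)
    (hF : p ∣ Fintype.card F) {d : ℕ} (hd : 0 < d) (c : ℕ) : ∀ k, d * c < k → k ≤ d * (c + 1) →
      ∃ P : MvPolynomial (Fin k) F, P.IsHomogeneous d ∧
        ∃ u, ¬ p ∣ u ∧ Nat.card {x : Fin k → F // eval x P = 0} = Fintype.card F ^ c * u := by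
  classical
  set Q := Fintype.card F with hQ
  have hQ1 : ∀ n, ¬ p ∣ (Q - 1) ^ n := fun n h => by
    have h1 := hp.dvd_of_dvd_pow h
    have h2 := Nat.dvd_sub hF h1
    rw [Nat.sub_sub_self (Fintype.card_pos)] at h2
    exact hp.one_lt.ne' (Nat.dvd_one.1 h2)
  have hU : ∀ n u, n ≠ 0 → u + (Q - 1) ^ n = Q ^ n → ¬ p ∣ u := fun n u hn h hpu =>
    hQ1 n ((Nat.dvd_add_right hpu).1 (h ▸ hF.trans (dvd_pow_self _ hn)))
  induction c with
  | zero =>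
    intro k hk0 hkd
    obtain ⟨j, rfl⟩ : ∃ j, k = j + 1 := ⟨k - 1, by omega⟩
    simp only [zero_add, mul_one] at hkd
    -- The power of `X 0` pads the degree to `d` without changing the zero set.
    refine ⟨X 0 ^ (d - (j + 1)) * ∏ i, X i, ?_, ?_⟩
    · have h := IsHomogeneous.prod Finset.univ
        (fun i : Fin (j + 1) => (X i : MvPolynomial (Fin (j + 1)) F)) (fun _ => 1)
        fun i _ => isHomogeneous_X F _
      have h2 := (isHomogeneous_X_pow (R := F) (0 : Fin (j + 1)) (d - (j + 1))).mul h
      simpa [Nat.sub_add_cancel hkd] using h2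
    · obtain ⟨u, hu, hsum⟩ := sum_ite_prod_eq_zero (F := F) (j + 1) 1 0
      refine ⟨u, hU _ _ (by omega) hu, ?_⟩
      rw [natCard_zeros_eq_sum, pow_zero, one_mul]
      rw [mul_one, mul_zero, add_zero] at hsum
      rw [← hsum]
      refine Finset.sum_congr rfl fun x _ => ?_
      congr 1
      simp only [map_mul, map_pow, eval_X, map_prod, mul_eq_zero, pow_eq_zero_iff', eq_iff_iff,
        or_iff_right_iff_imp, and_imp]
      exact fun h _ => Finset.prod_eq_zero (Finset.mem_univ 0) h
  | succ c ih =>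
    intro k hk1 hk2
    obtain ⟨j, rfl⟩ : ∃ j, k = d + j := ⟨k - d, by rw [mul_add] at hk1; omega⟩
    have hj1 : d * c < j := by nlinarith
    have hj2 : j ≤ d * (c + 1) := by nlinarith
    have hcj : c + 1 ≤ j := by nlinarith
    obtain ⟨n, rfl⟩ : ∃ n, d = n + 1 := ⟨d - 1, by omega⟩
    have hcard : Fintype.card (Option (Fin n ⊕ Fin j)) = n + 1 + j := by
      simp; omega
    obtain ⟨P, hP, u, hpu, hu⟩ : ∃ P : MvPolynomial (Fin j) F, P.IsHomogeneous (n + 1) ∧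
        ∃ u, ¬ p ∣ u ∧ Nat.card {x // eval x (addProd n P) = 0} = Q ^ (c + 1) * u := by
      -- If `j = c + 1`, the term `(Q - 1) ^ n * Q ^ j` already has exact order `Q ^ (c + 1)`, and
      -- `P = 0` makes the other term more divisible. If `j > c + 1`, the roles are exchanged; this
      -- forces `n ≠ 0`, which is needed for `u` to be prime to `p`.
      rcases hcj.eq_or_lt with hcj | hcj
      · refine ⟨0, isHomogeneous_zero _ _ _, ?_⟩
        obtain ⟨u, -, hz⟩ := natCard_zeros_addProd n (0 : MvPolynomial (Fin j) F)
        refine ⟨u * Q + (Q - 1) ^ n, fun h => hQ1 n ((Nat.dvd_add_right (hF.mul_left u)).1 h), ?_⟩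
        rw [hz]
        have h0 : Nat.card {x : Fin j → F // eval x (0 : MvPolynomial (Fin j) F) = 0} = Q ^ j := by
          rw [natCard_zeros_eq_sum]
          simp [hQ]
        rw [h0, Fintype.card_fin, ← hcj]
        ring
      · obtain ⟨P, hP, w, hw, hPw⟩ := ih j hj1 hj2
        refine ⟨P, hP, ?_⟩
        obtain ⟨u, hu, hz⟩ := natCard_zeros_addProd n P
        have hn : n ≠ 0 := by rintro rfl; omega
        obtain ⟨i, rfl⟩ : ∃ i, j = c + 1 + (i + 1) := ⟨j - (c + 1) - 1, by omega⟩
        refine ⟨u * w + (Q - 1) ^ n * Q ^ (i + 1), fun h => ?_, ?_⟩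
        · have h1 : p ∣ (Q - 1) ^ n * Q ^ (i + 1) :=
            (hF.trans (dvd_pow_self _ (by omega))).mul_left _
          exact (hp.dvd_mul.1 ((Nat.dvd_add_left h1).1 h)).elim (hU n u hn hu) hw
        · rw [hz, hPw, Fintype.card_fin]
          ring
    refine ⟨rename (Fintype.equivFinOfCardEq hcard) (addProd n P),
      (addProd_isHomogeneous n hP).rename_isHomogeneous, u, hpu, ?_⟩
    rw [natCard_zeros_rename, hu]

end Sharpness

/-! ### Ceilings, exact valuation and the main theorem. -/

theorem Nat.ceil_div_le_of_le_mul {a d B : ℕ} (hd : 0 < d) (h : a ≤ d * B) :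
    ⌈(a : ℚ) / d⌉₊ ≤ B := by
  rw [Nat.ceil_le, div_le_iff₀ (by exact_mod_cast hd)]
  exact_mod_cast h.trans_eq (mul_comm d B)

theorem Nat.ceil_div_eq_of_lt_of_le {k d c : ℕ} (hd : 0 < d) (h1 : d * c < k)
    (h2 : k ≤ d * (c + 1)) : ⌈(k : ℚ) / d⌉₊ = c + 1 := by
  refine le_antisymm (Nat.ceil_div_le_of_le_mul hd h2) ?_
  rw [Nat.succ_le_iff, Nat.lt_ceil, lt_div_iff₀ (by exact_mod_cast hd)]
  exact_mod_cast (mul_comm c d).trans_lt h1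

theorem padicValNat_eq_of_mul_add_eq {p f q M N k c u : ℕ} (hp : p.Prime) (hf : f ≠ 0)
    (hpq : p ∣ q) (hq : 1 < q) (hM : M * (q - 1) = p ^ f - 1) (hck : c + 1 ≤ k) (hu : ¬ p ∣ u)
    (h : M * N + (p ^ f) ^ k = M * (p ^ f) ^ k + p ^ f * ((p ^ f) ^ c * u)) :
    padicValNat p N = f * (c + 1) := by
  have : Fact p.Prime := ⟨hp⟩
  have hpM := not_dvd_of_mul_eq_pow_sub_one hp hf hM
  obtain ⟨L, rfl⟩ : ∃ L, M = L + 1 := ⟨M - 1, by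
    have : M ≠ 0 := by rintro rfl; simp at hpM
    omega⟩
  obtain ⟨j, rfl⟩ : ∃ j, k = c + 1 + j := ⟨k - (c + 1), by omega⟩
  -- `M ≡ 1` modulo `p`. This is needed when `k = c + 1`, where `(M - 1) Q ^ k` carries no extra
  -- power of `Q` over the main term.
  have hL : p ∣ L := by
    have h1 : L + p ^ f = (L + 1) * q := by
      obtain ⟨r, rfl⟩ : ∃ r, q = r + 1 := ⟨q - 1, by omega⟩
      have h2 : 1 ≤ p ^ f := Nat.one_le_pow _ _ hp.pos
      rw [Nat.add_sub_cancel] at hM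
      rw [mul_add, hM]
      omega
    exact (Nat.dvd_add_left (dvd_pow_self _ hf)).1 (h1 ▸ hpq.mul_left _)
  have hMN : (L + 1) * N = p ^ (f * (c + 1)) * (L * (p ^ f) ^ j + u) := by
    refine Nat.add_right_cancel (m := (p ^ f) ^ (c + 1 + j)) ?_
    rw [h, pow_mul]
    ring
  have hu' : ¬ p ∣ L * (p ^ f) ^ j + u := fun hdvd =>
    hu ((Nat.dvd_add_right (hL.mul_right _)).1 hdvd)
  have hu0 : L * (p ^ f) ^ j + u ≠ 0 := by intro h0; rw [h0] at hu'; simp at hu'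
  have hN0 : N ≠ 0 := by
    rintro rfl
    rw [mul_zero] at hMN
    exact mul_ne_zero (pow_ne_zero _ hp.ne_zero) hu0 hMN.symm
  have hval := congrArg (padicValNat p) hMN
  rwa [padicValNat.mul L.succ_ne_zero hN0, padicValNat.eq_zero_of_not_dvd hpM, zero_add,
    padicValNat.mul (pow_ne_zero _ hp.ne_zero) hu0, padicValNat.eq_zero_of_not_dvd hu',
    padicValNat.prime_pow, add_zero] at hval

theorem mainTheorem2 {F : Type*} [Field F] [Finite F] (p e q m k d g : ℕ)
    (hp : p.Prime) (he : 1 ≤ e) (hq : q = p ^ e) (hm : 1 ≤ m) (hF : Nat.card F = q ^ m)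
    (hk : 1 ≤ k) (hd : 1 ≤ d) (hg : g = Nat.gcd d ((q ^ m - 1) / (q - 1))) :
    (∀ f : MvPolynomial (Fin k) F, f.IsHomogeneous d →
      ⌈((e : ℚ) * m / g) * (⌈((g : ℚ) * k / d)⌉₊ : ℚ)⌉₊
        ≤ padicValNat p (artinSchreierCount q f)) ∧
    (g = 1 →
      (∀ f : MvPolynomial (Fin k) F, f.IsHomogeneous d →
        e * m * ⌈(k : ℚ) / d⌉₊ ≤ padicValNat p (artinSchreierCount q f)) ∧
      ∃ f : MvPolynomial (Fin k) F, f ≠ 0 ∧ f.IsHomogeneous d ∧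
        padicValNat p (artinSchreierCount q f) = e * m * ⌈(k : ℚ) / d⌉₊) := by
  have := Fintype.ofFinite F
  set M := (q ^ m - 1) / (q - 1) with hMdef
  have hcard : Fintype.card F = p ^ (e * m) := by
    rw [← Nat.card_eq_fintype_card, hF, hq, pow_mul]
  have hf : e * m ≠ 0 := by positivity
  have hM : M * (q - 1) = Fintype.card F - 1 := by
    rw [← Nat.card_eq_fintype_card, hF, hMdef]
    exact Nat.div_mul_cancel (by simpa using Nat.sub_dvd_pow_sub_pow q 1 m)
  have hbound : ∀ f : MvPolynomial (Fin k) F, f.IsHomogeneous d →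
      e * m * ⌈((g : ℚ) * k / d)⌉₊ ≤ g * padicValNat p (artinSchreierCount q f) := fun f hfd => by
    subst hg
    refine mul_le_gcd_mul_padicValNat hp hq (by omega) hcard hf hd hM hfd fun B hB => ?_
    exact_mod_cast Nat.ceil_div_le_of_le_mul hd hB
  refine ⟨fun f hfd => ?_, fun hg1 => ⟨fun f hfd => ?_, ?_⟩⟩
  · have hgpos : (0 : ℚ) < g := by
      rw [hg]
      exact_mod_cast Nat.gcd_pos_of_pos_left _ hd
    rw [Nat.ceil_le, div_mul_eq_mul_div, div_le_iff₀' hgpos]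
    exact_mod_cast hbound f hfd
  · have := hbound f hfd
    rwa [hg1, Nat.cast_one, one_mul, one_mul] at this
  · have hpF : p ∣ Fintype.card F := hcard ▸ dvd_pow_self _ hf
    have hchar : CharP F p := by
      rw [CharP.charP_iff_prime_eq_zero hp]
      have h := FiniteField.cast_card_eq_zero F
      rw [hcard, Nat.cast_pow] at h
      exact pow_eq_zero_iff hf |>.1 h
    obtain ⟨c, hc1, hc2⟩ : ∃ c, d * c < k ∧ k ≤ d * (c + 1) := by
      refine ⟨(k - 1) / d, ?_, ?_⟩
      · have := Nat.mul_div_le (k - 1) d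
        omega
      · have := Nat.lt_mul_div_succ (k - 1) hd
        omega
    have hck : c + 1 ≤ k := by nlinarith
    obtain ⟨P, hP, u, hu, hz⟩ := exists_isHomogeneous_natCard_zeros hp hpF hd c k hc1 hc2
    refine ⟨P, ?_, hP, ?_⟩
    -- The zero polynomial has `Q ^ k` zeros with `k > c`, which would make `u` divisible by `p`.
    · rintro rfl
      obtain ⟨j, rfl⟩ : ∃ j, k = c + (j + 1) := ⟨k - c - 1, by omega⟩
      apply hu
      have h0 : Fintype.card F ^ c * Fintype.card F ^ (j + 1) = Fintype.card F ^ c * u := by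
        rw [← hz, ← pow_add]
        simp
      rw [← Nat.eq_of_mul_eq_mul_left (pow_pos Fintype.card_pos c) h0]
      exact hpF.trans (dvd_pow_self _ (by omega))
    · have hrel := mul_artinSchreierCount_add_of_coprime hp hq (by omega) hd hM
        (hg.symm.trans hg1) hP
      rw [hz, hcard] at hrel
      rw [Nat.ceil_div_eq_of_lt_of_le hd hc1 hc2]
      exact padicValNat_eq_of_mul_add_eq hp hf (hq ▸ dvd_pow_self _ (by omega))
        (hq ▸ Nat.one_lt_pow (by omega) hp.one_lt) (hcard ▸ hM) hck hu hrel
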